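/- Let $m\ge 1$, let $Y$ be an arbitrary random vector in $\mathbb{R}^m$, let $\Sigma\in\mathbb{R}^{m\times m}$ be (symmetric) positive definite, let $N_\Sigma$ be a centered Gaussian random vector with covariance matrix $\Sigma$, let $\varphi_\Sigma$ be its density, and let $I$ be the identity matrix. For $\ell\in\mathbb{N}=\{1,2,\dots\}$ let $\mathbb{H}_\ell$ be the set of indicator functions of intersections of $\ell$ closed half-spaces in $\mathbb{R}^m$, and let $\mathcal{I}_m$ be the set of indicator functions of closed convex sets in $\mathbb{R}^m$. For random vectors $Y,Z$ in $\mathbb{R}^m$ put $$d_{\mathbb{H}_\ell}(Y,Z):=\sup_{h\in\mathbb{H}_\ell}|\mathbb{E}h(Y)-\mathbb{E}h(Z)|,\qquad d_{convex}(Y,Z):=\sup_{h\in\mathcal{I}_m}|\mathbb{E}h(Y)-\mathbb{E}h(Z)|.$$ For bounded measurable $h:\mathbb{R}^m\to\mathbb{R}$ and $t\in(0,1)$ put $$f_{t,h,\Sigma}(y):=\frac12\int_t^1\frac1{1-s}\int_{\mathbb{R}^m}\big(h(\sqrt s\,z+\sqrt{1-s}\,y)-h(z)\big)\varphi_\Sigma(z)\,dz\,ds,\qquad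 y\in\mathbb{R}^m .$$ For $h\in\mathbb{H}_\ell$ and for $h\in\mathcal{I}_m$ the integral over $s$ converges absolutely for every $y$, and $f_{t,h,\Sigma}$ is twice continuously differentiable. Define $$M_2:=\frac14\sum_{i,j=1}^m\bigg(\int_{\mathbb{R}^m}\bigg|\frac{\partial^2\varphi_I}{\partial y_i\partial y_j}(z)\bigg|\,dz\bigg)^2 .$$ Then $M_2\le m^2$, $$\sup_{h\in\mathbb{H}_\ell}\mathbb{E}\sum_{i,j=1}^m\bigg(\frac{\partial^2 f_{t,h,\Sigma}}{\partial y_i\partial y_j}(Y)\bigg)^2\le\|\Sigma^{-1}\|_{op}^2\big(M_2(\log t)^2\,d_{\mathbb{H}_{2\ell}}(Y,N_\Sigma)+444\,m^{23/6}\big)$$ for all $t\in(0,1)$ and $\ell\in\mathbb{N}$, and $$\sup_{h\in\mathcal{I}_m}\mathbb{E}\sum_{i,j=1}^m\bigg(\frac{\partial^2 f_{t,h,\Sigma}}{\partial y_i\partial y_j}(Y)\bigg)^2\le\|\Sigma^{-1}\|_{op}^2\big(M_2(\log t)^2\,d_{convex}(Y,N_\Sigma)+444\,m^{23/6}\big)$$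 for all $t\in(0,1)$, where $\|\cdot\|_{op}$ is the operator norm with respect to the Euclidean norm. -/

import Mathlib

open MeasureTheory ProbabilityTheory Set

noncomputable section

namespace SteinHessian

/-- The density `φ_Σ` of the centered Gaussian distribution on `ℝ^m` with positive definite
covariance matrix `S`. -/
def gaussianDensity {m : ℕ} (S : Matrix (Fin m) (Fin m) ℝ) (z : EuclideanSpace ℝ (Fin m)) : ℝ :=
  (Real.sqrt ((2 * Real.pi) ^ m * S.det))⁻¹ *
    Real.exp (-(1 / 2) * inner ℝ z (Matrix.toEuclideanCLM (𝕜 := ℝ) S⁻¹ z))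

/-- The partial derivative `∂f/∂y_i` at `y`. -/
def partialDeriv {m : ℕ} (i : Fin m) (f : EuclideanSpace ℝ (Fin m) → ℝ)
    (y : EuclideanSpace ℝ (Fin m)) : ℝ :=
  lineDeriv ℝ f y (EuclideanSpace.single i 1)

/-- The second partial derivative `∂²f/∂y_i∂y_j` at `y`. -/
def partialDeriv₂ {m : ℕ} (i j : Fin m) (f : EuclideanSpace ℝ (Fin m) → ℝ)
    (y : EuclideanSpace ℝ (Fin m)) : ℝ :=
  partialDeriv i (partialDeriv j f) y

/-- The operator norm of a real matrix with respect to the Euclidean norm. -/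
def opNorm {m : ℕ} (A : Matrix (Fin m) (Fin m) ℝ) : ℝ :=
  ‖Matrix.toEuclideanCLM (𝕜 := ℝ) A‖

/-- The integrand in the variable `s` of the smoothed Stein solution:
`(1 - s)⁻¹ ∫ (h(√s z + √(1-s) y) - h(z)) φ_Σ(z) dz`. -/
def steinIntegrand {m : ℕ} (h : EuclideanSpace ℝ (Fin m) → ℝ) (S : Matrix (Fin m) (Fin m) ℝ)
    (y : EuclideanSpace ℝ (Fin m)) (s : ℝ) : ℝ :=
  1 / (1 - s) *
    ∫ z, (h (Real.sqrt s • z + Real.sqrt (1 - s) • y) - h z) * gaussianDensity S z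

/-- The smoothed Stein solution `f_{t,h,Σ}`. -/
def steinSolution {m : ℕ} (t : ℝ) (h : EuclideanSpace ℝ (Fin m) → ℝ)
    (S : Matrix (Fin m) (Fin m) ℝ) (y : EuclideanSpace ℝ (Fin m)) : ℝ :=
  1 / 2 * ∫ s in t..1, steinIntegrand h S y s

/-- The squared Hilbert-Schmidt norm of the Hessian of `f` at `y`. -/
def hessianSqNorm {m : ℕ} (f : EuclideanSpace ℝ (Fin m) → ℝ) (y : EuclideanSpace ℝ (Fin m)) : ℝ :=
  ∑ i : Fin m, ∑ j : Fin m, (partialDeriv₂ i j f y) ^ 2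

/-- The constant `M_2 = (1/4) ∑_{i,j} (∫ |∂²φ_I/∂y_i∂y_j|)²`. -/
def M₂ (m : ℕ) : ℝ :=
  1 / 4 * ∑ i : Fin m, ∑ j : Fin m,
    (∫ z, |partialDeriv₂ i j (gaussianDensity (1 : Matrix (Fin m) (Fin m) ℝ)) z|) ^ 2

/-- Closed half-spaces `{x | ⟨x, u⟩ ≤ c}` with a unit vector `u` and a real number `c`. -/
def IsClosedHalfSpace {m : ℕ} (H : Set (EuclideanSpace ℝ (Fin m))) : Prop :=
  ∃ (u : EuclideanSpace ℝ (Fin m)) (c : ℝ), ‖u‖ = 1 ∧ H = {x | inner ℝ x u ≤ c}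

/-- The class `ℍ_ℓ` of indicator functions of intersections of `ℓ` closed half-spaces in `ℝ^m`
(the half-spaces need not be distinct). -/
def halfSpaceIndicators (m l : ℕ) : Set (EuclideanSpace ℝ (Fin m) → ℝ) :=
  {h | ∃ H : Fin l → Set (EuclideanSpace ℝ (Fin m)),
    (∀ k, IsClosedHalfSpace (H k)) ∧ h = indicator (⋂ k, H k) (fun _ => 1)}

/-- The class `𝓘_m` of indicator functions of closed convex sets in `ℝ^m`. -/
def convexIndicators (m : ℕ) : Set (EuclideanSpace ℝ (Fin m) → ℝ) :=
  {h | ∃ A : Set (EuclideanSpace ℝ (Fin m)),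
    IsClosed A ∧ Convex ℝ A ∧ h = indicator A (fun _ => 1)}

/-- The distance `sup_{h ∈ G} |E h(Y) - E h(Z)|` between two random vectors, possibly on different
probability spaces. For the classes of indicator functions used here the supremum is over a set of
numbers in `[0, 1]`. -/
def testDist {m : ℕ} {Ω Ω' : Type*} [MeasurableSpace Ω] [MeasurableSpace Ω']
    (G : Set (EuclideanSpace ℝ (Fin m) → ℝ)) (P : Measure Ω) (Y : Ω → EuclideanSpace ℝ (Fin m))
    (Q : Measure Ω') (Z : Ω' → EuclideanSpace ℝ (Fin m)) : ℝ :=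
  ⨆ h : G, |(∫ ω, h.1 (Y ω) ∂P) - ∫ ω, h.1 (Z ω) ∂Q|

end SteinHessian

end

noncomputable section

namespace SteinHessian

open Filter Topology
open scoped MatrixOrder

/-! Write γ for the standard Gaussian law and φ for its density. The substitution z = √Σ w gives
f_{t,h,Σ}(y) = f_{t,h∘√Σ,I}(Σ^{-1/2} y), and composing with Σ^{-1/2} enlarges the Hilbert-Schmidt
norm of the Hessian by at most ‖Σ^{-1/2}‖² = ‖Σ⁻¹‖. So the covariance may be taken to be I.

Shifting the Gaussian variable puts both y-derivatives on φ: ∂_ij f(y) = ∫_t^1 ∫ (1/2s) ∂_ijφ(z)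
h(√s z + √(1-s) y) dz ds. This is a signed mixture of rescaled translates of h, of total mass ½ |log
t| ∫|∂_ijφ|. Its square is a double mixture of products of two indicators, and these products lie in
ℍ_{2ℓ}, respectively 𝓘_m. Hence replacing the law of Y by the Gaussian one costs at most M₂ (log t)²
d (`sum_integral_steinHess_sq_le_add`).

What remains is the Gaussian second moment of the Hessian, which is at most 1 for the indicator of
any closed set (`sum_integral_steinHess_sq_le`). Put L = Δ − y·∇, g(y) = E h(√t Z + √(1-t) y), c = E
h(Z). For a test function h one has −Lf = g − c (`stein_equation`), and differentiating, −L∂_i f +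
∂_i f = ∂_i g. Integrating by parts under γ, ∫‖D²f‖² = ∑_i ∫ ∂_i f (−L∂_i f) ≤ ∫ ∇f·∇g = ∫ g (−Lf) =
∫ g(g − c) ≤ 1 when 0 ≤ h ≤ 1 (`sum_integral_timeAvg_sq_le`). Indicators of closed sets are
pointwise limits of test functions, and the kernel formula passes to the limit by dominated
convergence. Finally 1 ≤ 444 m^{23/6}.

The bound on M₂ comes from ∫|∂_ijφ| ≤ 2. -/

/-- Euclidean space of dimension `m`. -/
abbrev Euc (m : ℕ) := EuclideanSpace ℝ (Fin m)

variable {m : ℕ}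

/-- The `i`-th standard basis vector. -/
abbrev stdBasis (i : Fin m) : Euc m := EuclideanSpace.single i 1

/-- The standard Gaussian density. -/
abbrev stdDensity (z : Euc m) : ℝ := gaussianDensity (1 : Matrix (Fin m) (Fin m) ℝ) z

/-! ### The standard Gaussian: density, moments, integration by parts. -/

lemma stdDensity_eq (z : Euc m) :
    stdDensity z = (Real.sqrt ((2 * Real.pi) ^ m))⁻¹ * Real.exp (-(1 / 2) * ‖z‖ ^ 2) := by
  simp [stdDensity, gaussianDensity]

lemma stdDensity_pos (z : Euc m) : 0 < stdDensity z := by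
  rw [stdDensity_eq]; positivity

lemma continuous_stdDensity : Continuous (stdDensity : Euc m → ℝ) := by
  have : (stdDensity : Euc m → ℝ) =
      fun z ↦ (Real.sqrt ((2 * Real.pi) ^ m))⁻¹ * Real.exp (-(1 / 2) * ‖z‖ ^ 2) :=
    funext stdDensity_eq
  rw [this]; fun_prop

lemma integrable_exp_neg_mul_sq_norm {b : ℝ} (hb : 0 < b) :
    Integrable (fun z : Euc m ↦ Real.exp (-b * ‖z‖ ^ 2)) := by
  have h := GaussianFourier.integrable_cexp_neg_mul_sq_norm_add (V := Euc m) (b := (b : ℂ))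
    (by simpa using hb) 0 0
  refine h.norm.congr (ae_of_all _ fun z ↦ ?_)
  simp [Complex.norm_exp, ← Complex.ofReal_pow]

lemma integrable_stdDensity : Integrable (stdDensity : Euc m → ℝ) := by
  simp_rw [funext stdDensity_eq]
  exact (integrable_exp_neg_mul_sq_norm (by norm_num)).const_mul _

lemma integral_stdDensity : ∫ z : Euc m, stdDensity z = 1 := by
  simp_rw [stdDensity_eq]
  rw [integral_const_mul, GaussianFourier.integral_rexp_neg_mul_sq_norm (by norm_num)]
  have : Real.pi / (1 / 2) = 2 * Real.pi := by ring
  rw [this, finrank_euclideanSpace_fin, Real.sqrt_eq_rpow, ← Real.rpow_natCast,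
    ← Real.rpow_mul (by positivity), mul_one_div]
  exact inv_mul_cancel₀ (by positivity)

lemma isProbabilityMeasure_withDensity_stdDensity :
    IsProbabilityMeasure
      ((volume : Measure (Euc m)).withDensity fun z ↦ ENNReal.ofReal (stdDensity z)) := by
  refine ⟨?_⟩
  rw [withDensity_apply _ MeasurableSet.univ, Measure.restrict_univ,
    ← ofReal_integral_eq_lintegral_ofReal integrable_stdDensity
      (ae_of_all _ fun z ↦ (stdDensity_pos z).le), integral_stdDensity, ENNReal.ofReal_one]

lemma measurable_ofReal_stdDensity :
    Measurable fun z : Euc m ↦ ENNReal.ofReal (stdDensity z) :=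
  continuous_stdDensity.measurable.ennreal_ofReal

lemma integral_withDensity_stdDensity {F : Type*} [NormedAddCommGroup F] [NormedSpace ℝ F]
    (g : Euc m → F) :
    ∫ z, g z ∂((volume : Measure (Euc m)).withDensity fun z ↦ ENNReal.ofReal (stdDensity z)) =
      ∫ z, stdDensity z • g z := by
  rw [integral_withDensity_eq_integral_toReal_smul measurable_ofReal_stdDensity
    (ae_of_all _ fun _ ↦ ENNReal.ofReal_lt_top)]
  simp_rw [ENNReal.toReal_ofReal (stdDensity_pos _).le]

/-- Both laws have characteristic function exp(-‖t‖²/2). The Fourier integral at frequency 0,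
compared with total mass one, supplies the cancellation of the normalising constant. -/
lemma stdGaussian_eq_withDensity :
    stdGaussian (Euc m) = volume.withDensity fun z ↦ ENNReal.ofReal (stdDensity z) := by
  have := isProbabilityMeasure_withDensity_stdDensity (m := m)
  apply Measure.ext_of_charFun
  ext t
  rw [charFun_stdGaussian, charFun_apply, integral_withDensity_stdDensity]
  have h := GaussianFourier.integral_cexp_neg_mul_sq_norm_add (V := Euc m) (b := (1 / 2 : ℂ))
    (by norm_num) Complex.I t
  have h0 := GaussianFourier.integral_cexp_neg_mul_sq_norm_add (V := Euc m) (b := (1 / 2 : ℂ))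
    (by norm_num) 0 t
  have h1 : ∫ z : Euc m, ((stdDensity z : ℝ) : ℂ) = 1 := by
    rw [integral_complex_ofReal, integral_stdDensity]; simp
  have e1 : ∀ z : Euc m, ((stdDensity z : ℝ) : ℂ) =
      ((Real.sqrt ((2 * Real.pi) ^ m))⁻¹ : ℝ) * Complex.exp (-(1 / 2 : ℂ) * (‖z‖ : ℂ) ^ 2) := by
    intro z; rw [stdDensity_eq]; push_cast; rfl
  simp_rw [e1] at h1
  rw [integral_const_mul] at h1
  simp only [zero_mul, add_zero] at h0
  rw [h0] at h1
  simp_rw [Complex.real_smul, e1, mul_assoc, ← Complex.exp_add]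
  rw [integral_const_mul]
  have e2 : ∀ z : Euc m, -(1 / 2 : ℂ) * (‖z‖ : ℂ) ^ 2 + ((inner ℝ z t : ℝ) : ℂ) * Complex.I
      = -(1 / 2 : ℂ) * (‖z‖ : ℂ) ^ 2 + Complex.I * ((inner ℝ t z : ℝ) : ℂ) := by
    intro z; rw [real_inner_comm]; ring
  simp_rw [e2, h]
  have h1' : ((Real.sqrt ((2 * Real.pi) ^ m))⁻¹ : ℝ) *
      ((Real.pi : ℂ) / (1 / 2)) ^ ((Module.finrank ℝ (Euc m) : ℂ) / 2) = 1 := by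
    simpa using h1
  rw [← mul_assoc, h1', one_mul, Complex.I_sq]
  congr 1; ring

lemma integral_stdGaussian {F : Type*} [NormedAddCommGroup F] [NormedSpace ℝ F]
    (g : Euc m → F) : ∫ z, g z ∂(stdGaussian (Euc m)) = ∫ z, stdDensity z • g z := by
  rw [stdGaussian_eq_withDensity, integral_withDensity_stdDensity]

lemma integrable_stdGaussian_iff {g : Euc m → ℝ} :
    Integrable g (stdGaussian (Euc m)) ↔ Integrable fun z ↦ stdDensity z * g z := by
  rw [stdGaussian_eq_withDensity, integrable_withDensity_iff_integrable_smul'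
    measurable_ofReal_stdDensity (ae_of_all _ fun _ ↦ ENNReal.ofReal_lt_top)]
  simp_rw [ENNReal.toReal_ofReal (stdDensity_pos _).le, smul_eq_mul]

lemma integrable_norm_pow_stdGaussian (n : ℕ) :
    Integrable (fun z : Euc m ↦ ‖z‖ ^ n) (stdGaussian (Euc m)) := by
  have h : MemLp (id : Euc m → Euc m) n (stdGaussian (Euc m)) :=
    IsGaussian.memLp_id _ _ (ENNReal.natCast_ne_top n)
  exact h.integrable_norm_pow'

lemma hasFDerivAt_stdDensity (z : Euc m) :
    HasFDerivAt stdDensity (-(stdDensity z) • innerSL ℝ z) z := by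
  have h : HasFDerivAt (fun z : Euc m ↦ (Real.sqrt ((2 * Real.pi) ^ m))⁻¹ *
      Real.exp (-(1 / 2) * ‖z‖ ^ 2)) _ z :=
    (((hasStrictFDerivAt_norm_sq z).hasFDerivAt.const_mul (-(1 / 2))).exp).const_mul
      (Real.sqrt ((2 * Real.pi) ^ m))⁻¹
  rw [show (stdDensity : Euc m → ℝ) = _ from funext stdDensity_eq]
  refine h.congr_fderiv ?_
  ext v
  simp
  ring

lemma abs_coord_le (z : Euc m) (j : Fin m) : |z j| ≤ ‖z‖ := PiLp.norm_apply_le z j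

lemma inner_stdBasis (z : Euc m) (j : Fin m) : inner ℝ z (stdBasis j) = z j := by
  rw [stdBasis, EuclideanSpace.inner_single_right]; simp

/-- Gaussian integration by parts. -/
lemma integral_lineDeriv_stdGaussian {G G' : Euc m → ℝ} {j : Fin m}
    (hG : Continuous G) (hG' : Continuous G') {C : ℝ} (hC : ∀ x, |G x| ≤ C)
    (hC' : ∀ x, |G' x| ≤ C) (hd : ∀ x, HasLineDerivAt ℝ G (G' x) x (stdBasis j)) :
    ∫ x, G' x ∂(stdGaussian (Euc m)) = ∫ x, x j * G x ∂(stdGaussian (Euc m)) := by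
  have hi : ∀ H : Euc m → ℝ, Continuous H → (∀ x, |H x| ≤ C) →
      Integrable H (stdGaussian (Euc m)) := fun H h1 h2 ↦
    Integrable.of_bound h1.aestronglyMeasurable C (ae_of_all _ h2)
  have hi2 : Integrable (fun x : Euc m ↦ x j * G x) (stdGaussian (Euc m)) := by
    have h1 : Integrable (fun x : Euc m ↦ x j) (stdGaussian (Euc m)) :=
      ((integrable_norm_pow_stdGaussian 1).mono' (by fun_prop)
        (ae_of_all _ fun z ↦ by simpa using abs_coord_le z j))
    exact h1.mul_bdd (c := C) hG.aestronglyMeasurable (ae_of_all _ hC)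
  have hi0 := hi G hG hC
  have hi1 := hi G' hG' hC'
  rw [integrable_stdGaussian_iff] at hi0 hi1 hi2
  rw [integral_stdGaussian, integral_stdGaussian]
  have key := integral_bilinear_hasLineDerivAt_right_eq_neg_left_of_integrable
    (μ := (volume : Measure (Euc m))) (f := stdDensity) (f' := fun x ↦ -(stdDensity x) * x j)
    (g := G) (g' := G') (v := stdBasis j) (B := ContinuousLinearMap.mul ℝ ℝ)
    (by
      refine hi2.neg.congr (ae_of_all _ fun x ↦ ?_)
      simp; ring) (by simpa using hi1) (by simpa using hi0)
    (fun x _ ↦ by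
      have := (hasFDerivAt_stdDensity x).hasLineDerivAt (stdBasis j)
      simpa [inner_stdBasis] using this) (fun x _ ↦ hd x)
  simp only [ContinuousLinearMap.mul_apply', smul_eq_mul] at key ⊢
  rw [key, ← integral_neg]
  congr 1; ext x; ring

/-! ### The square root of the covariance and the change of variables it induces. -/

section Covariance

variable {S : Matrix (Fin m) (Fin m) ℝ}

/-- The symmetric square root of a covariance matrix, as a linear map. -/
def sqrtCLM (S : Matrix (Fin m) (Fin m) ℝ) : Euc m →L[ℝ] Euc m :=
  Matrix.toEuclideanCLM (𝕜 := ℝ) (CFC.sqrt S)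

/-- The inverse of the symmetric square root of a covariance matrix, as a linear map. -/
def invSqrtCLM (S : Matrix (Fin m) (Fin m) ℝ) : Euc m →L[ℝ] Euc m :=
  Matrix.toEuclideanCLM (𝕜 := ℝ) (CFC.sqrt S)⁻¹

lemma sqrt_mul_sqrt (hS : S.PosDef) : CFC.sqrt S * CFC.sqrt S = S :=
  CFC.sqrt_mul_sqrt_self _ hS.posSemidef.nonneg

lemma det_sqrt_sq (hS : S.PosDef) : (CFC.sqrt S).det ^ 2 = S.det := by
  rw [sq, ← Matrix.det_mul, sqrt_mul_sqrt hS]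

lemma det_sqrt_ne_zero (hS : S.PosDef) : (CFC.sqrt S).det ≠ 0 := by
  intro h
  have := det_sqrt_sq hS
  rw [h] at this
  exact hS.det_pos.ne' (by simpa using this.symm)

lemma sqrtCLM_invSqrtCLM (hS : S.PosDef) (y : Euc m) : sqrtCLM S (invSqrtCLM S y) = y := by
  rw [sqrtCLM, invSqrtCLM, ← mul_apply_eq_comp, ← map_mul,
    Matrix.mul_nonsing_inv _ (det_sqrt_ne_zero hS).isUnit, map_one]
  rfl

lemma invSqrtCLM_sqrtCLM (hS : S.PosDef) (y : Euc m) : invSqrtCLM S (sqrtCLM S y) = y := by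
  rw [sqrtCLM, invSqrtCLM, ← mul_apply_eq_comp, ← map_mul,
    Matrix.nonsing_inv_mul _ (det_sqrt_ne_zero hS).isUnit, map_one]
  rfl

lemma isSelfAdjoint_invSqrt : IsSelfAdjoint (CFC.sqrt S)⁻¹ := by
  have h : IsSelfAdjoint (CFC.sqrt S) := (CFC.sqrt_nonneg S).isSelfAdjoint
  exact (Matrix.IsHermitian.inv h)

/-- The C*-identity for a self-adjoint operator. Through it, the two copies of Σ^{-1/2} in the
transformed Hessian become the factor ‖Σ⁻¹‖_op. -/
lemma norm_invSqrtCLM_sq (hS : S.PosDef) : ‖invSqrtCLM S‖ ^ 2 = opNorm S⁻¹ := by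
  have h : IsSelfAdjoint (invSqrtCLM S) := isSelfAdjoint_invSqrt.map _
  rw [← h.norm_mul_self, opNorm, invSqrtCLM, ← map_mul, ← Matrix.mul_inv_rev, sqrt_mul_sqrt hS]

lemma sqrtCLM_symm (x y : Euc m) : inner ℝ (sqrtCLM S x) y = inner ℝ x (sqrtCLM S y) := by
  have h : IsSelfAdjoint (sqrtCLM S) := (CFC.sqrt_nonneg S).isSelfAdjoint.map _
  rw [← ContinuousLinearMap.adjoint_inner_right, h.adjoint_eq]

lemma gaussianDensity_sqrtCLM (hS : S.PosDef) (w : Euc m) :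
    gaussianDensity S (sqrtCLM S w) = |(CFC.sqrt S).det|⁻¹ * stdDensity w := by
  have h1 : inner ℝ (sqrtCLM S w) (Matrix.toEuclideanCLM (𝕜 := ℝ) S⁻¹ (sqrtCLM S w)) =
      ‖w‖ ^ 2 := by
    rw [sqrtCLM_symm]
    have : sqrtCLM S (Matrix.toEuclideanCLM (𝕜 := ℝ) S⁻¹ (sqrtCLM S w)) = w := by
      rw [sqrtCLM, ← mul_apply_eq_comp, ← mul_apply_eq_comp,
        ← map_mul, ← map_mul]
      have e : CFC.sqrt S * (S⁻¹ * CFC.sqrt S) = 1 := by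
        conv_lhs => rw [← sqrt_mul_sqrt hS, Matrix.mul_inv_rev, sqrt_mul_sqrt hS]
        rw [mul_assoc, Matrix.nonsing_inv_mul _ (det_sqrt_ne_zero hS).isUnit, mul_one,
          Matrix.mul_nonsing_inv _ (det_sqrt_ne_zero hS).isUnit]
      rw [mul_assoc, e, map_one]; rfl
    rw [this, real_inner_self_eq_norm_sq]
  rw [gaussianDensity, h1, stdDensity_eq, ← det_sqrt_sq hS, Real.sqrt_mul (by positivity),
    Real.sqrt_sq_eq_abs, mul_inv]
  ring

lemma det_sqrtCLM : (sqrtCLM S : Euc m →ₗ[ℝ] Euc m).det = (CFC.sqrt S).det := by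
  have : (sqrtCLM S : Euc m →ₗ[ℝ] Euc m) = Matrix.toLin (EuclideanSpace.basisFun (Fin m) ℝ).toBasis
      (EuclideanSpace.basisFun (Fin m) ℝ).toBasis (CFC.sqrt S) := rfl
  rw [this, LinearMap.det_toLin]

/-- The Jacobian of √Σ cancels the factor |det √Σ|⁻¹ in the density; this is the source of the
reduction to covariance I. -/
lemma integral_mul_gaussianDensity (hS : S.PosDef) (F : Euc m → ℝ) :
    ∫ z, F z * gaussianDensity S z = ∫ w, F (sqrtCLM S w) * stdDensity w := by
  have hd : (sqrtCLM S : Euc m →ₗ[ℝ] Euc m).det ≠ 0 := by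
    rw [det_sqrtCLM]; exact det_sqrt_ne_zero hS
  have hmap := Measure.map_linearMap_addHaar_eq_smul_addHaar (volume : Measure (Euc m)) hd
  have hinj : Function.Injective (sqrtCLM S) :=
    Function.LeftInverse.injective (invSqrtCLM_sqrtCLM hS)
  have hemb : MeasurableEmbedding (sqrtCLM S) :=
    (sqrtCLM S).continuous.measurableEmbedding hinj
  have h := hemb.integral_map (μ := (volume : Measure (Euc m)))
    (fun z ↦ F z * gaussianDensity S z)
  have hmap' : Measure.map (sqrtCLM S) (volume : Measure (Euc m)) = _ := hmap
  rw [hmap', integral_smul_measure, det_sqrtCLM] at h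
  simp_rw [gaussianDensity_sqrtCLM hS] at h
  rw [ENNReal.toReal_ofReal (abs_nonneg _), abs_inv] at h
  have hne : |(CFC.sqrt S).det|⁻¹ ≠ 0 := inv_ne_zero (abs_ne_zero.2 (det_sqrt_ne_zero hS))
  refine mul_left_cancel₀ hne ?_
  rw [← smul_eq_mul, h, ← integral_const_mul]
  congr 1; ext w; ring

end Covariance

open scoped ContDiff

/-! ### Differentiation under weighted averages of `F(a + b y)`. -/

section WeightedAverage

variable {α : Type*} [MeasurableSpace α] {ρ : Measure α} {w b : α → ℝ} {a : α → Euc m}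
  {F F' : Euc m → ℝ} {C : ℝ}

/-- The weighted average `y ↦ ∫ w(p) F(a(p) + b(p) y) ρ(dp)`. -/
def weightedAvg (ρ : Measure α) (w b : α → ℝ) (a : α → Euc m) (F : Euc m → ℝ) (y : Euc m) : ℝ :=
  ∫ p, w p * F (a p + b p • y) ∂ρ

lemma integrable_weightedAvg (hw : Integrable w ρ) (hb : Measurable b) (ha : Measurable a)
    (hF : Continuous F) (hC : ∀ x, |F x| ≤ C) (y : Euc m) :
    Integrable (fun p ↦ w p * F (a p + b p • y)) ρ :=
  hw.mul_bdd (c := C)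
    (hF.measurable.comp
      (show Measurable fun p ↦ a p + b p • y by fun_prop)).aestronglyMeasurable
    (ae_of_all _ fun _ ↦ hC _)

lemma abs_weightedAvg_le (hw : Integrable w ρ) (hC : ∀ x, |F x| ≤ C) (y : Euc m) :
    |weightedAvg ρ w b a F y| ≤ (∫ p, |w p| ∂ρ) * C := by
  rw [weightedAvg, ← integral_mul_const, ← Real.norm_eq_abs]
  refine (norm_integral_le_of_norm_le (hw.abs.mul_const C) (ae_of_all _ fun p ↦ ?_))
  rw [Real.norm_eq_abs, abs_mul]
  exact mul_le_mul_of_nonneg_left (hC _) (abs_nonneg _)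

lemma continuous_weightedAvg (hw : Integrable w ρ) (hb : Measurable b) (ha : Measurable a)
    (hF : Continuous F) (hC : ∀ x, |F x| ≤ C) : Continuous (weightedAvg ρ w b a F) := by
  refine continuous_of_dominated
    (fun y ↦ (integrable_weightedAvg hw hb ha hF hC y).aestronglyMeasurable)
    (bound := fun p ↦ |w p| * C) (fun y ↦ ae_of_all _ fun p ↦ ?_) (hw.abs.mul_const C)
    (ae_of_all _ fun p ↦ by fun_prop)
  rw [Real.norm_eq_abs, abs_mul]
  exact mul_le_mul_of_nonneg_left (hC _) (abs_nonneg _)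

/-- The chain rule produces a factor b(p), which is absorbed into the weight, so such averages are
stable under differentiation. As |b| ≤ 1, the dominating function |w| C serves again. -/
lemma hasLineDerivAt_weightedAvg (hw : Integrable w ρ) (hb : Measurable b) (ha : Measurable a)
    (hb1 : ∀ᵐ p ∂ρ, |b p| ≤ 1) (hF : Continuous F) (hF' : Continuous F') (hC : ∀ x, |F x| ≤ C)
    (hC' : ∀ x, |F' x| ≤ C) {v : Euc m} (hd : ∀ x, HasLineDerivAt ℝ F (F' x) x v) (y : Euc m) :
    HasLineDerivAt ℝ (weightedAvg ρ w b a F)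
      (weightedAvg ρ (fun p ↦ w p * b p) b a F' y) y v := by
  have hwb : Integrable (fun p ↦ w p * b p) ρ :=
    hw.mul_bdd (c := 1) hb.aestronglyMeasurable hb1
  have hC0 : 0 ≤ C := (abs_nonneg _).trans (hC 0)
  have key := hasDerivAt_integral_of_dominated_loc_of_deriv_le (μ := ρ) (𝕜 := ℝ)
    (F := fun (t : ℝ) p ↦ w p * F (a p + b p • (y + t • v)))
    (F' := fun (t : ℝ) p ↦ w p * b p * F' (a p + b p • (y + t • v)))
    (x₀ := 0) (s := univ) (bound := fun p ↦ |w p| * C) univ_mem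
    (Eventually.of_forall fun t ↦
      (integrable_weightedAvg hw hb ha hF hC (y + t • v)).aestronglyMeasurable)
    (integrable_weightedAvg hw hb ha hF hC (y + (0 : ℝ) • v))
    (integrable_weightedAvg hwb hb ha hF' hC' (y + (0 : ℝ) • v)).aestronglyMeasurable
    (hb1.mono fun p hp t _ ↦ by
      rw [Real.norm_eq_abs, abs_mul, abs_mul]
      exact mul_le_mul (mul_le_of_le_one_right (abs_nonneg _) hp) (hC' _) (abs_nonneg _)
        (abs_nonneg _))
    (hw.abs.mul_const C)
    (ae_of_all _ fun p t _ ↦ by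
      have h1 : HasDerivAt (fun u : ℝ ↦ F (a p + b p • (y + t • v) + u • v))
          (F' (a p + b p • (y + t • v))) 0 := hd _
      -- `hd` only gives a derivative at parameter 0. Around time t the curve is therefore
      -- reparametrised by u ↦ b(u - t), which vanishes at u = t.
      have h2 : HasDerivAt (fun u : ℝ ↦ b p * (u - t)) (b p) t := by
        simpa using ((hasDerivAt_id t).sub_const t).const_mul (b p)
      have h1' : HasDerivAt (fun u : ℝ ↦ F (a p + b p • (y + t • v) + u • v))
          (F' (a p + b p • (y + t • v))) (b p * (t - t)) := by simpa using h1
      have h3 := (h1'.comp t h2).const_mul (w p)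
      have e : (fun u : ℝ ↦ w p * F (a p + b p • (y + u • v))) = fun u ↦ w p *
          ((fun u : ℝ ↦ F (a p + b p • (y + t • v) + u • v)) ∘ fun u ↦ b p * (u - t)) u := by
        ext u
        simp only [Function.comp]
        congr 2
        module
      rw [e, mul_assoc, mul_comm (b p)]
      exact h3)
  have h := key.2
  simp only [zero_smul, add_zero] at h
  exact h

end WeightedAverage

/-! ### Test functions and their partial derivatives. -/

/-- Smooth functions with compact support. -/
structure IsTest (F : Euc m → ℝ) : Prop where
  contDiff : ContDiff ℝ ∞ F
  hasCompactSupport : HasCompactSupport F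

/-- The `i`-th partial derivative, through the Fréchet derivative. -/
def dir (i : Fin m) (F : Euc m → ℝ) (x : Euc m) : ℝ := fderiv ℝ F x (stdBasis i)

namespace IsTest

variable {F : Euc m → ℝ}

lemma continuous (hF : IsTest F) : Continuous F := hF.contDiff.continuous

lemma differentiable (hF : IsTest F) : Differentiable ℝ F := hF.contDiff.differentiable (by simp)

lemma dir (hF : IsTest F) (i : Fin m) : IsTest (dir i F) where
  contDiff := (hF.contDiff.fderiv_right (m := ∞) (by simp)).clm_apply contDiff_const
  hasCompactSupport := hF.hasCompactSupport.fderiv_apply (𝕜 := ℝ) (stdBasis i)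

lemma exists_bound (hF : IsTest F) : ∃ C, ∀ x, |F x| ≤ C :=
  hF.hasCompactSupport.exists_bound_of_continuous hF.continuous

lemma hasLineDerivAt (hF : IsTest F) (i : Fin m) (x : Euc m) :
    HasLineDerivAt ℝ F (SteinHessian.dir i F x) x (stdBasis i) :=
  (hF.differentiable x).hasFDerivAt.hasLineDerivAt _

lemma dir_comm (hF : IsTest F) (i j : Fin m) :
    SteinHessian.dir i (SteinHessian.dir j F) = SteinHessian.dir j (SteinHessian.dir i F) := by
  have h1 : ∀ k l : Fin m, ∀ x, SteinHessian.dir k (SteinHessian.dir l F) x =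
      fderiv ℝ (fderiv ℝ F) x (stdBasis k) (stdBasis l) := by
    intro k l x
    have hd : DifferentiableAt ℝ (fderiv ℝ F) x :=
      (hF.contDiff.fderiv_right (m := ∞) (by simp)).differentiable (by simp) x
    unfold SteinHessian.dir
    rw [fderiv_clm_apply hd (differentiableAt_const _)]
    simp
  ext x
  rw [h1, h1]
  exact (hF.contDiff.contDiffAt.isSymmSndFDerivAt (by
    rw [minSmoothness_of_isRCLikeNormedField]; exact WithTop.coe_le_coe.2 le_top)) _ _

end IsTest

/-! ### Ornstein-Uhlenbeck averages and their time integrals. -/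

/-- The Ornstein-Uhlenbeck average `E F(√s Z + √(1-s) y)`. -/
def ouMean (s : ℝ) (F : Euc m → ℝ) (y : Euc m) : ℝ :=
  ∫ z, F (Real.sqrt s • z + Real.sqrt (1 - s) • y) ∂(stdGaussian (Euc m))

/-- The product of Lebesgue measure on `(t, 1)` and the standard Gaussian measure. -/
def timeGaussian (m : ℕ) (t : ℝ) : Measure (ℝ × Euc m) :=
  (volume.restrict (Ioo t 1)).prod (stdGaussian (Euc m))

instance (t : ℝ) : IsFiniteMeasure (timeGaussian m t) := by
  unfold timeGaussian; infer_instance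

/-- The time integral `∫_t^1 w(s) E F(√s Z + √(1-s) y) ds`. -/
def timeAvg (t : ℝ) (w : ℝ → ℝ) (F : Euc m → ℝ) : Euc m → ℝ :=
  weightedAvg (timeGaussian m t) (fun p ↦ w p.1) (fun p ↦ Real.sqrt (1 - p.1))
    (fun p ↦ Real.sqrt p.1 • p.2) F

section TimeAvg

variable {t : ℝ} {w : ℝ → ℝ} {F : Euc m → ℝ}

lemma integrable_weight (hw : IntegrableOn w (Ioo t 1)) :
    Integrable (fun p : ℝ × Euc m ↦ w p.1) (timeGaussian m t) :=
  hw.comp_fst _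

lemma timeAvg_eq (hw : IntegrableOn w (Ioo t 1)) (hF : IsTest F) (y : Euc m) :
    IntegrableOn (fun s ↦ w s * ouMean s F y) (Ioo t 1) ∧
      timeAvg t w F y = ∫ s in Ioo t 1, w s * ouMean s F y := by
  obtain ⟨C, hC⟩ := hF.exists_bound
  have h := integrable_weightedAvg (integrable_weight (m := m) hw)
    (b := fun p ↦ Real.sqrt (1 - p.1)) (a := fun p ↦ Real.sqrt p.1 • p.2)
    (by fun_prop) (by fun_prop) hF.continuous hC y
  unfold timeGaussian at h
  refine ⟨?_, ?_⟩
  · have := h.integral_prod_left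
    simp only [integral_const_mul] at this
    exact this
  · unfold timeAvg weightedAvg timeGaussian
    rw [integral_prod _ h]
    simp only [integral_const_mul, ouMean]

end TimeAvg

/-- The weight `1 / (2 √(1 - s))`. -/
def rootWeight (s : ℝ) : ℝ := 1 / (2 * Real.sqrt (1 - s))

lemma intervalIntegrable_rootWeight {t : ℝ} (ht : t < 1) :
    IntervalIntegrable rootWeight volume t 1 := by
  have h := (intervalIntegral.intervalIntegrable_rpow' (a := 1 - t) (b := 0) (r := -(1 / 2))
    (by norm_num)).comp_sub_left 1
  simp only [sub_sub_cancel, sub_zero] at h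
  refine (h.const_mul (1 / 2)).congr_uIoo fun s hs ↦ ?_
  rw [uIoo_of_le ht.le] at hs
  have hs1 : 0 ≤ 1 - s := by linarith [hs.2]
  simp only
  rw [rootWeight, Real.rpow_neg hs1, ← Real.sqrt_eq_rpow]
  simp [mul_comm]

lemma integrableOn_rootWeight {t : ℝ} (ht : t < 1) : IntegrableOn rootWeight (Ioo t 1) :=
  ((intervalIntegrable_iff_integrableOn_Ioo_of_le ht.le).1 (intervalIntegrable_rootWeight ht))

lemma continuous_ouMean {F : Euc m → ℝ} (hF : IsTest F) (y : Euc m) :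
    Continuous fun s ↦ ouMean s F y := by
  obtain ⟨C, hC⟩ := hF.exists_bound
  have hc := hF.continuous
  refine continuous_of_dominated (bound := fun _ ↦ C) (fun s ↦ ?_)
    (fun s ↦ ae_of_all _ fun z ↦ hC _) (integrable_const _) (ae_of_all _ fun z ↦ by fun_prop)
  exact (by fun_prop : Continuous _).aestronglyMeasurable

lemma fderiv_eq_sum (F : Euc m → ℝ) (x v : Euc m) : fderiv ℝ F x v = ∑ j, v j * dir j F x := by
  have hv : v = ∑ j, v j • stdBasis j := by
    have := (EuclideanSpace.basisFun (Fin m) ℝ).sum_repr v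
    simpa using this.symm
  conv_lhs => rw [hv]
  simp [dir]

/-- Gaussian integration by parts. The s here will be √s: it cancels the derivative 1/(2√s) of √s
and leaves the coefficient 1/2 of the Laplacian. -/
lemma integral_coord_mul {F : Euc m → ℝ} (hF : IsTest F) (s c : ℝ) (y : Euc m) (j : Fin m) :
    ∫ z, z j * F (s • z + c • y) ∂(stdGaussian (Euc m)) =
      s * ∫ z, dir j F (s • z + c • y) ∂(stdGaussian (Euc m)) := by
  obtain ⟨C, hC⟩ := hF.exists_bound
  obtain ⟨C', hC'⟩ := (hF.dir j).exists_bound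
  have hc := hF.continuous
  have hc' := (hF.dir j).continuous
  rw [← integral_const_mul]
  refine (integral_lineDeriv_stdGaussian (C := max C (|s| * C')) (by fun_prop) (by fun_prop)
    (fun x ↦ le_max_of_le_left (hC _)) (fun x ↦ ?_) (fun x ↦ ?_)).symm
  · rw [abs_mul]
    exact le_max_of_le_right (mul_le_mul_of_nonneg_left (hC' _) (abs_nonneg _))
  · have h1 : HasFDerivAt (fun z : Euc m ↦ F (s • z + c • y)) _ x :=
      (hF.differentiable (s • x + c • y)).hasFDerivAt.comp x
        (((hasFDerivAt_id x).const_smul s).add_const (c • y))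
    have := h1.hasLineDerivAt (stdBasis j)
    simpa [dir] using this

/-- The time derivative of the Ornstein-Uhlenbeck average. -/
lemma hasDerivAt_ouMean {F : Euc m → ℝ} (hF : IsTest F) (y : Euc m) {s : ℝ}
    (hs : s ∈ Ioo (0 : ℝ) 1) :
    HasDerivAt (fun s ↦ ouMean s F y)
      (∑ j, ((1 / 2) * ouMean s (dir j (dir j F)) y - y j * (rootWeight s * ouMean s (dir j F) y)))
      s := by
  obtain ⟨C, hC⟩ : ∃ C, ∀ x, ‖fderiv ℝ F x‖ ≤ C :=
    (hF.hasCompactSupport.fderiv (𝕜 := ℝ)).exists_bound_of_continuous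
      (hF.contDiff.continuous_fderiv (by simp))
  obtain ⟨CF, hCF⟩ := hF.exists_bound
  have hc := hF.continuous
  have hC0 : 0 ≤ C := (norm_nonneg _).trans (hC 0)
  -- On `U` both u and 1 - u stay away from 0, so the derivatives of √u and √(1-u) are bounded by
  -- the constant `K` below.
  set U : Set ℝ := Ioo (s / 2) ((1 + s) / 2) with hU
  have hUs : U ∈ 𝓝 s := Ioo_mem_nhds (by linarith [hs.1]) (by linarith [hs.2])
  set d : ℝ → Euc m → Euc m := fun u z ↦
    (1 / (2 * Real.sqrt u)) • z + (-1 / (2 * Real.sqrt (1 - u))) • y with hd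
  set K : ℝ := max (1 / (2 * Real.sqrt (s / 2))) (1 / (2 * Real.sqrt ((1 - s) / 2))) with hK
  have hpos1 : 0 < Real.sqrt (s / 2) := Real.sqrt_pos.2 (by linarith [hs.1])
  have hpos2 : 0 < Real.sqrt ((1 - s) / 2) := Real.sqrt_pos.2 (by linarith [hs.2])
  have key := hasDerivAt_integral_of_dominated_loc_of_deriv_le (μ := stdGaussian (Euc m)) (𝕜 := ℝ)
    (F := fun (u : ℝ) z ↦ F (Real.sqrt u • z + Real.sqrt (1 - u) • y))
    (F' := fun (u : ℝ) z ↦ fderiv ℝ F (Real.sqrt u • z + Real.sqrt (1 - u) • y) (d u z))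
    (x₀ := s) (s := U) (bound := fun z ↦ C * (K * ‖z‖ + K * ‖y‖)) hUs
    (Eventually.of_forall fun u ↦ (by fun_prop : Continuous _).aestronglyMeasurable)
    (Integrable.of_bound (by fun_prop : Continuous _).aestronglyMeasurable CF
      (ae_of_all _ fun z ↦ hCF _))
    (by
      have := hF.contDiff.continuous_fderiv (n := ∞) (by simp)
      exact (by fun_prop : Continuous _).aestronglyMeasurable)
    (ae_of_all _ fun z u hu ↦ by
      refine (ContinuousLinearMap.le_opNorm _ _).trans
        (mul_le_mul (hC _) ?_ (norm_nonneg _) hC0)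
      refine (norm_add_le _ _).trans ?_
      have h1 : |1 / (2 * Real.sqrt u)| ≤ K := by
        rw [abs_of_nonneg (by positivity)]
        refine le_max_of_le_left ?_
        have : Real.sqrt (s / 2) ≤ Real.sqrt u := Real.sqrt_le_sqrt hu.1.le
        gcongr
      have h2 : |-1 / (2 * Real.sqrt (1 - u))| ≤ K := by
        rw [neg_div, abs_neg, abs_of_nonneg (by positivity)]
        refine le_max_of_le_right ?_
        have : Real.sqrt ((1 - s) / 2) ≤ Real.sqrt (1 - u) :=
          Real.sqrt_le_sqrt (by linarith [hu.2])
        gcongr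
      rw [norm_smul, norm_smul, Real.norm_eq_abs, Real.norm_eq_abs]
      gcongr)
    (by
      have := (integrable_norm_pow_stdGaussian (m := m) 1)
      simp only [pow_one] at this
      exact ((this.const_mul K).add (integrable_const _)).const_mul C)
    (ae_of_all _ fun z u hu ↦ by
      have hu0 : u ≠ 0 := by have := hs.1; have := hu.1; intro h; linarith
      have hu1 : 1 - u ≠ 0 := by have := hs.2; have := hu.2; intro h; linarith
      have h1 := (Real.hasDerivAt_sqrt hu0).smul_const z
      have h2 := (((hasDerivAt_id u).const_sub 1).sqrt hu1).smul_const y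
      exact (hF.differentiable _).hasFDerivAt.comp_hasDerivAt u (h1.add h2))
  have h2 := key.2
  refine h2.congr_deriv ?_
  have hi : ∀ G : Euc m → ℝ, IsTest G → Integrable
      (fun z ↦ G (Real.sqrt s • z + Real.sqrt (1 - s) • y)) (stdGaussian (Euc m)) := by
    intro G hG
    obtain ⟨CG, hCG⟩ := hG.exists_bound
    have hcG := hG.continuous
    exact Integrable.of_bound (by fun_prop : Continuous _).aestronglyMeasurable CG
      (ae_of_all _ fun z ↦ hCG _)
  have hi' : ∀ G : Euc m → ℝ, IsTest G → ∀ j, Integrable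
      (fun z ↦ z j * G (Real.sqrt s • z + Real.sqrt (1 - s) • y)) (stdGaussian (Euc m)) := by
    intro G hG j
    obtain ⟨CG, hCG⟩ := hG.exists_bound
    have hcG := hG.continuous
    have h1 : Integrable (fun x : Euc m ↦ x j) (stdGaussian (Euc m)) :=
      ((integrable_norm_pow_stdGaussian 1).mono' (by fun_prop)
        (ae_of_all _ fun z ↦ by simpa using abs_coord_le z j))
    exact h1.mul_bdd (c := CG) (by fun_prop : Continuous _).aestronglyMeasurable
      (ae_of_all _ fun _ ↦ hCG _)
  have e : ∀ z : Euc m, fderiv ℝ F (Real.sqrt s • z + Real.sqrt (1 - s) • y) (d s z) =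
      ∑ j, ((1 / (2 * Real.sqrt s)) *
          (z j * dir j F (Real.sqrt s • z + Real.sqrt (1 - s) • y)) -
        y j * (rootWeight s * dir j F (Real.sqrt s • z + Real.sqrt (1 - s) • y))) := by
    intro z
    rw [fderiv_eq_sum]
    refine Finset.sum_congr rfl fun j _ ↦ ?_
    simp [hd, rootWeight]
    ring
  simp_rw [e]
  rw [integral_finsetSum]
  · refine Finset.sum_congr rfl fun j _ ↦ ?_
    rw [integral_sub ((hi' _ (hF.dir j) j).const_mul _)
      (((hi _ (hF.dir j)).const_mul _).const_mul _), integral_const_mul, integral_const_mul,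
      integral_const_mul, integral_coord_mul (hF.dir j)]
    simp only [ouMean]
    have : Real.sqrt s ≠ 0 := (Real.sqrt_pos.2 hs.1).ne'
    field_simp
  · exact fun j _ ↦ ((hi' _ (hF.dir j) j).const_mul _).sub
      (((hi _ (hF.dir j)).const_mul _).const_mul _)

/-! ### Bounded continuous functions, and spatial derivatives of the averages. -/

/-- Bounded continuous real functions. -/
def IsBddCont (f : Euc m → ℝ) : Prop := Continuous f ∧ ∃ C, ∀ x, |f x| ≤ C

namespace IsBddCont

variable {f g : Euc m → ℝ}

lemma mul (hf : IsBddCont f) (hg : IsBddCont g) : IsBddCont fun x ↦ f x * g x := by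
  obtain ⟨hf, C, hC⟩ := hf
  obtain ⟨hg, D, hD⟩ := hg
  refine ⟨hf.mul hg, C * D, fun x ↦ ?_⟩
  rw [abs_mul]
  exact mul_le_mul (hC x) (hD x) (abs_nonneg _) ((abs_nonneg _).trans (hC x))

lemma add (hf : IsBddCont f) (hg : IsBddCont g) : IsBddCont fun x ↦ f x + g x := by
  obtain ⟨hf, C, hC⟩ := hf
  obtain ⟨hg, D, hD⟩ := hg
  exact ⟨hf.add hg, C + D, fun x ↦ (abs_add_le _ _).trans (add_le_add (hC x) (hD x))⟩

lemma integrable (hf : IsBddCont f) : Integrable f (stdGaussian (Euc m)) := by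
  obtain ⟨hf, C, hC⟩ := hf
  exact Integrable.of_bound hf.aestronglyMeasurable C (ae_of_all _ hC)

lemma integrable_coord_mul (hf : IsBddCont f) (j : Fin m) :
    Integrable (fun x ↦ x j * f x) (stdGaussian (Euc m)) := by
  obtain ⟨hf, C, hC⟩ := hf
  have h1 : Integrable (fun x : Euc m ↦ x j) (stdGaussian (Euc m)) :=
    ((integrable_norm_pow_stdGaussian 1).mono' (by fun_prop)
      (ae_of_all _ fun z ↦ by simpa using abs_coord_le z j))
  exact h1.mul_bdd (c := C) hf.aestronglyMeasurable (ae_of_all _ hC)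

/-- Gaussian integration by parts. -/
lemma integral_lineDeriv (hf : IsBddCont f) (hg : IsBddCont g) {j : Fin m}
    (hd : ∀ x, HasLineDerivAt ℝ f (g x) x (stdBasis j)) :
    ∫ x, g x ∂(stdGaussian (Euc m)) = ∫ x, x j * f x ∂(stdGaussian (Euc m)) := by
  obtain ⟨hf, C, hC⟩ := hf
  obtain ⟨hg, D, hD⟩ := hg
  exact integral_lineDeriv_stdGaussian hf hg (C := max C D)
    (fun x ↦ (hC x).trans (le_max_left _ _)) (fun x ↦ (hD x).trans (le_max_right _ _)) hd

end IsBddCont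

/-- The product rule for line derivatives. -/
lemma hasLineDerivAt_mul {f g : Euc m → ℝ} {f' g' : ℝ} {x v : Euc m}
    (hf : HasLineDerivAt ℝ f f' x v) (hg : HasLineDerivAt ℝ g g' x v) :
    HasLineDerivAt ℝ (fun x ↦ f x * g x) (f' * g x + f x * g') x v := by
  have h := HasDerivAt.mul (𝕜 := ℝ) (c := fun t : ℝ ↦ f (x + t • v))
    (d := fun t : ℝ ↦ g (x + t • v)) hf hg
  simpa using! h

lemma isBddCont_timeAvg {t : ℝ} {w : ℝ → ℝ} {F : Euc m → ℝ} (hw : IntegrableOn w (Ioo t 1))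
    (hF : IsTest F) : IsBddCont (timeAvg t w F) := by
  obtain ⟨C, hC⟩ := hF.exists_bound
  exact ⟨continuous_weightedAvg (integrable_weight hw) (by fun_prop) (by fun_prop)
    hF.continuous hC, _, abs_weightedAvg_le (integrable_weight hw) hC⟩

lemma hasLineDerivAt_timeAvg {t : ℝ} (ht : 0 < t) {w : ℝ → ℝ} {F : Euc m → ℝ}
    (hw : IntegrableOn w (Ioo t 1)) (hF : IsTest F) (j : Fin m) (y : Euc m) :
    HasLineDerivAt ℝ (timeAvg t w F)
      (timeAvg t (fun s ↦ w s * Real.sqrt (1 - s)) (dir j F) y) y (stdBasis j) := by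
  obtain ⟨C, hC⟩ := hF.exists_bound
  obtain ⟨D, hD⟩ := (hF.dir j).exists_bound
  have hb : ∀ᵐ p ∂(timeGaussian m t), |Real.sqrt (1 - p.1)| ≤ 1 := by
    have h : ∀ᵐ s ∂(volume.restrict (Ioo t 1)), |Real.sqrt (1 - s)| ≤ 1 := by
      filter_upwards [ae_restrict_mem measurableSet_Ioo] with s hs
      rw [abs_of_nonneg (Real.sqrt_nonneg _)]
      exact Real.sqrt_le_one.2 (by linarith [hs.1])
    exact Measure.quasiMeasurePreserving_fst.ae h
  exact hasLineDerivAt_weightedAvg (C := max C D) (integrable_weight hw) (by fun_prop)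
    (by fun_prop) hb hF.continuous (hF.dir j).continuous
    (fun x ↦ (hC x).trans (le_max_left _ _)) (fun x ↦ (hD x).trans (le_max_right _ _))
    (hF.hasLineDerivAt j) y

lemma ouMean_eq_weightedAvg (s : ℝ) (F : Euc m → ℝ) :
    ouMean s F = weightedAvg (stdGaussian (Euc m)) (fun _ ↦ 1) (fun _ ↦ Real.sqrt (1 - s))
      (fun z ↦ Real.sqrt s • z) F := by
  ext y; simp [ouMean, weightedAvg]

lemma isBddCont_ouMean (s : ℝ) {F : Euc m → ℝ} (hF : IsTest F) : IsBddCont (ouMean s F) := by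
  obtain ⟨C, hC⟩ := hF.exists_bound
  rw [ouMean_eq_weightedAvg]
  exact ⟨continuous_weightedAvg (integrable_const _) (by fun_prop) (by fun_prop)
    hF.continuous hC, _, abs_weightedAvg_le (integrable_const _) hC⟩

lemma hasLineDerivAt_ouMean {s : ℝ} (hs : 0 ≤ s) {F : Euc m → ℝ} (hF : IsTest F) (j : Fin m)
    (y : Euc m) :
    HasLineDerivAt ℝ (ouMean s F) (Real.sqrt (1 - s) * ouMean s (dir j F) y) y (stdBasis j) := by
  obtain ⟨C, hC⟩ := hF.exists_bound
  obtain ⟨D, hD⟩ := (hF.dir j).exists_bound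
  have h := hasLineDerivAt_weightedAvg (ρ := stdGaussian (Euc m)) (w := fun _ ↦ 1)
    (b := fun _ ↦ Real.sqrt (1 - s)) (a := fun z : Euc m ↦ Real.sqrt s • z) (C := max C D)
    (integrable_const _) (by fun_prop) (by fun_prop) (ae_of_all _ fun _ ↦ by
      rw [abs_of_nonneg (Real.sqrt_nonneg _)]
      exact Real.sqrt_le_one.2 (by linarith)) hF.continuous (hF.dir j).continuous
    (fun x ↦ (hC x).trans (le_max_left _ _)) (fun x ↦ (hD x).trans (le_max_right _ _))
    (hF.hasLineDerivAt j) y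
  rw [← ouMean_eq_weightedAvg] at h
  convert h using 1
  simp [ouMean, weightedAvg, integral_const_mul]

/-! ### The Stein equation and the Bochner argument for test functions. -/

section Bochner

variable {t : ℝ} {h : Euc m → ℝ}

/-- The weight `rootWeight s * √(1 - s)`, which is `1 / 2` for `s < 1`. -/
def halfWeight (s : ℝ) : ℝ := rootWeight s * Real.sqrt (1 - s)

lemma halfWeight_eq {s : ℝ} (hs : s < 1) : halfWeight s = 1 / 2 := by
  have : Real.sqrt (1 - s) ≠ 0 := (Real.sqrt_pos.2 (by linarith)).ne'
  rw [halfWeight, rootWeight]; field_simp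

lemma integrableOn_mul_sqrt (ht : 0 < t) {w : ℝ → ℝ} (hw : IntegrableOn w (Ioo t 1)) :
    IntegrableOn (fun s ↦ w s * Real.sqrt (1 - s)) (Ioo t 1) := by
  refine Integrable.mul_bdd (c := 1) hw (by fun_prop : Continuous _).aestronglyMeasurable ?_
  filter_upwards [ae_restrict_mem measurableSet_Ioo] with s hs
  rw [Real.norm_eq_abs, abs_of_nonneg (Real.sqrt_nonneg _)]
  exact Real.sqrt_le_one.2 (by linarith [hs.1])

lemma integrableOn_halfWeight (ht : 0 < t) (ht1 : t < 1) : IntegrableOn halfWeight (Ioo t 1) :=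
  integrableOn_mul_sqrt ht (integrableOn_rootWeight ht1)

/-- The Stein equation for test functions. -/
lemma stein_equation (ht : 0 < t) (ht1 : t < 1) (hh : IsTest h) (y : Euc m) :
    ∑ j, (y j * timeAvg t rootWeight (dir j h) y - timeAvg t halfWeight (dir j (dir j h)) y) =
      ouMean t h y - ∫ z, h z ∂(stdGaussian (Euc m)) := by
  have hA := fun j ↦ timeAvg_eq (integrableOn_rootWeight ht1) (hh.dir j) y
  have hB := fun j ↦ timeAvg_eq (integrableOn_halfWeight ht ht1) ((hh.dir j).dir j) y
  have hAB : ∀ j, IntegrableOn (fun s ↦ halfWeight s * ouMean s (dir j (dir j h)) y -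
      y j * (rootWeight s * ouMean s (dir j h) y)) (Ioo t 1) := fun j ↦
    (hB j).1.sub ((hA j).1.const_mul (y j))
  have hint : IntegrableOn (fun s ↦ ∑ j, (halfWeight s * ouMean s (dir j (dir j h)) y -
      y j * (rootWeight s * ouMean s (dir j h) y))) (Ioo t 1) :=
    integrable_finsetSum _ fun j _ ↦ hAB j
  -- The integrand is the time derivative of the Ornstein-Uhlenbeck average. At s = 1 that average
  -- no longer depends on y and equals the Gaussian mean of h.
  have hftc : ∫ s in t..1, ∑ j, (halfWeight s * ouMean s (dir j (dir j h)) y -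
      y j * (rootWeight s * ouMean s (dir j h) y)) = ouMean 1 h y - ouMean t h y := by
    refine intervalIntegral.integral_eq_sub_of_hasDerivAt_of_le ht1.le
      (continuous_ouMean hh y).continuousOn (fun s hs ↦ ?_)
      ((intervalIntegrable_iff_integrableOn_Ioo_of_le ht1.le).2 hint)
    rw [halfWeight_eq hs.2]
    exact hasDerivAt_ouMean hh y ⟨ht.trans hs.1, hs.2⟩
  rw [intervalIntegral.integral_of_le ht1.le, integral_Ioc_eq_integral_Ioo,
    integral_finsetSum _ fun j _ ↦ hAB j] at hftc
  have h1 : ouMean 1 h y = ∫ z, h z ∂(stdGaussian (Euc m)) := by simp [ouMean]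
  rw [← h1, ← neg_sub, ← hftc, ← Finset.sum_neg_distrib]
  refine Finset.sum_congr rfl fun j _ ↦ ?_
  rw [integral_sub (hB j).1 ((hA j).1.const_mul (y j)), integral_const_mul, ← (hA j).2,
    ← (hB j).2]
  ring

/-- The Stein equation, differentiated once. -/
lemma stein_equation_deriv (ht : 0 < t) (ht1 : t < 1) (hh : IsTest h) (i : Fin m) (y : Euc m) :
    timeAvg t rootWeight (dir i h) y + ∑ j, (y j * timeAvg t halfWeight (dir j (dir i h)) y -
      timeAvg t (fun s ↦ halfWeight s * Real.sqrt (1 - s)) (dir j (dir j (dir i h))) y) =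
      Real.sqrt (1 - t) * ouMean t (dir i h) y := by
  have hR : HasLineDerivAt ℝ (fun y ↦ ouMean t h y - ∫ z, h z ∂(stdGaussian (Euc m)))
      (Real.sqrt (1 - t) * ouMean t (dir i h) y) y (stdBasis i) :=
    HasDerivAt.sub_const _ (hasLineDerivAt_ouMean ht.le hh i y)
  have hcoord : ∀ j, HasLineDerivAt ℝ (fun y : Euc m ↦ y j) ((stdBasis i : Euc m) j) y
      (stdBasis i) := fun j ↦
    (EuclideanSpace.proj (𝕜 := ℝ) j : Euc m →L[ℝ] ℝ).hasFDerivAt.hasLineDerivAt _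
  have hL : HasLineDerivAt ℝ (fun y ↦ ∑ j, (y j * timeAvg t rootWeight (dir j h) y -
      timeAvg t halfWeight (dir j (dir j h)) y))
      (∑ j, (((stdBasis i : Euc m) j * timeAvg t rootWeight (dir j h) y +
        y j * timeAvg t halfWeight (dir i (dir j h)) y) -
        timeAvg t (fun s ↦ halfWeight s * Real.sqrt (1 - s)) (dir i (dir j (dir j h))) y))
      y (stdBasis i) :=
    HasDerivAt.fun_sum fun j _ ↦ HasDerivAt.sub
      (hasLineDerivAt_mul (hcoord j)
        (hasLineDerivAt_timeAvg ht (integrableOn_rootWeight ht1) (hh.dir j) i y))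
      (hasLineDerivAt_timeAvg ht (integrableOn_halfWeight ht ht1) ((hh.dir j).dir j) i y)
  rw [funext fun y ↦ stein_equation ht ht1 hh y] at hL
  rw [← hL.unique hR]
  -- This zeroth order term arises from differentiating the coefficients y_j; its sign is what makes
  -- it droppable in the Bochner bound.
  have e1 : timeAvg t rootWeight (dir i h) y =
      ∑ j, (stdBasis i : Euc m) j * timeAvg t rootWeight (dir j h) y := by
    simp [stdBasis]
  rw [e1, ← Finset.sum_add_distrib]
  refine Finset.sum_congr rfl fun j _ ↦ ?_
  rw [hh.dir_comm i j, (hh.dir j).dir_comm i j, hh.dir_comm i j]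
  ring

/-- The Bochner type bound: the Hessian of the Stein solution of a test function with values in
`[0, 1]` is bounded in `L²` of the standard Gaussian measure. -/
theorem sum_integral_timeAvg_sq_le (ht : 0 < t) (ht1 : t < 1) (hh : IsTest h)
    (h0 : ∀ x, 0 ≤ h x) (h1 : ∀ x, h x ≤ 1) :
    ∑ i, ∑ j, ∫ y, (timeAvg t halfWeight (dir j (dir i h)) y) ^ 2 ∂(stdGaussian (Euc m)) ≤ 1 := by
  set γ := stdGaussian (Euc m)
  -- With f the Stein solution, `U i` is ∂_i f, `V i j` is ∂_j∂_i f, `X i j` is ∂_j∂_j∂_i f, and `G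
  -- i` is ∂_i g.
  set U := fun i ↦ timeAvg t rootWeight (dir i h) with hU
  set V := fun i j ↦ timeAvg t halfWeight (dir j (dir i h)) with hV
  set X := fun i j ↦ timeAvg t (fun s ↦ halfWeight s * Real.sqrt (1 - s))
    (dir j (dir j (dir i h))) with hX
  set g := ouMean t h with hg
  set G := fun i y ↦ Real.sqrt (1 - t) * ouMean t (dir i h) y with hG
  have bU : ∀ i, IsBddCont (U i) := fun i ↦
    isBddCont_timeAvg (integrableOn_rootWeight ht1) (hh.dir i)
  have bV : ∀ i j, IsBddCont (V i j) := fun i j ↦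
    isBddCont_timeAvg (integrableOn_halfWeight ht ht1) ((hh.dir i).dir j)
  have bX : ∀ i j, IsBddCont (X i j) := fun i j ↦
    isBddCont_timeAvg (integrableOn_mul_sqrt ht (integrableOn_halfWeight ht ht1))
      (((hh.dir i).dir j).dir j)
  have bg : IsBddCont g := isBddCont_ouMean t hh
  have bc : ∀ c : ℝ, IsBddCont (fun _ : Euc m ↦ c) := fun c ↦
    ⟨continuous_const, |c|, fun _ ↦ le_rfl⟩
  have bG : ∀ i, IsBddCont (G i) := fun i ↦ (bc _).mul (isBddCont_ouMean t (hh.dir i))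
  have dU : ∀ i j y, HasLineDerivAt ℝ (U i) (V i j y) y (stdBasis j) := fun i j y ↦
    hasLineDerivAt_timeAvg ht (integrableOn_rootWeight ht1) (hh.dir i) j y
  have dV : ∀ i j y, HasLineDerivAt ℝ (V i j) (X i j y) y (stdBasis j) := fun i j y ↦
    hasLineDerivAt_timeAvg ht (integrableOn_halfWeight ht ht1) ((hh.dir i).dir j) j y
  have dg : ∀ i y, HasLineDerivAt ℝ g (G i y) y (stdBasis i) := fun i y ↦
    hasLineDerivAt_ouMean ht.le hh i y
  -- Integration by parts applied to the product ∂_i f · ∂_j∂_i f along e_j.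
  have integral_V_sq : ∀ i j, ∫ y, (V i j y) ^ 2 ∂γ = ∫ y, U i y * (y j * V i j y - X i j y) ∂γ := by
    intro i j
    have hI := ((bU i).mul (bV i j)).integral_lineDeriv
      (((bV i j).mul (bV i j)).add ((bU i).mul (bX i j)))
      fun y ↦ hasLineDerivAt_mul (dU i j y) (dV i j y)
    rw [integral_add ((bV i j).mul (bV i j)).integrable ((bU i).mul (bX i j)).integrable] at hI
    have e : ∀ y : Euc m, U i y * (y j * V i j y - X i j y) =
        y j * (U i y * V i j y) - U i y * X i j y := fun y ↦ by ring
    simp_rw [e, sq]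
    rw [integral_sub (((bU i).mul (bV i j)).integrable_coord_mul j)
      ((bU i).mul (bX i j)).integrable]
    linarith
  have i1 : ∀ i j, Integrable (fun y ↦ U i y * (y j * V i j y - X i j y)) γ := by
    intro i j
    refine ((((bU i).mul (bV i j)).integrable_coord_mul j).sub
      ((bU i).mul (bX i j)).integrable).congr (ae_of_all _ fun y ↦ ?_)
    simp only [Pi.sub_apply]; ring
  have sum_V_sq_le : ∀ i, ∑ j, ∫ y, (V i j y) ^ 2 ∂γ ≤ ∫ y, U i y * G i y ∂γ := by
    intro i
    simp_rw [integral_V_sq]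
    rw [← integral_finsetSum _ fun j _ ↦ i1 i j]
    refine integral_mono (integrable_finsetSum _ fun j _ ↦ i1 i j)
      ((bU i).mul (bG i)).integrable fun y ↦ ?_
    simp only
    rw [← Finset.mul_sum]
    have := stein_equation_deriv ht ht1 hh i y
    -- The differentiated Stein equation turns the integrand into U_i (G_i − U_i), and −U_i² is
    -- discarded.
    have e : ∑ j, (y j * V i j y - X i j y) = G i y - U i y := by
      simp only [hU, hV, hX, hG]; linarith
    rw [e]
    nlinarith [sq_nonneg (U i y)]
  -- A second integration by parts, for ∂_i f · g along e_i, takes the derivative off g; only the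
  -- bound 0 ≤ g ≤ 1 will be needed.
  have integral_U_mul_G : ∀ i, ∫ y, U i y * G i y ∂γ = ∫ y, g y * (y i * U i y - V i i y) ∂γ := by
    intro i
    have hI := ((bU i).mul bg).integral_lineDeriv
      (((bV i i).mul bg).add ((bU i).mul (bG i)))
      fun y ↦ hasLineDerivAt_mul (dU i i y) (dg i y)
    rw [integral_add ((bV i i).mul bg).integrable ((bU i).mul (bG i)).integrable] at hI
    have e : ∀ y : Euc m, g y * (y i * U i y - V i i y) =
        y i * (U i y * g y) - V i i y * g y := fun y ↦ by ring
    simp_rw [e]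
    rw [integral_sub (((bU i).mul bg).integrable_coord_mul i) ((bV i i).mul bg).integrable]
    linarith
  have i3 : ∀ i, Integrable (fun y ↦ g y * (y i * U i y - V i i y)) γ := by
    intro i
    refine ((((bU i).mul bg).integrable_coord_mul i).sub
      ((bV i i).mul bg).integrable).congr (ae_of_all _ fun y ↦ ?_)
    simp only [Pi.sub_apply]; ring
  have hhi : ∀ y, Integrable
      (fun z ↦ h (Real.sqrt t • z + Real.sqrt (1 - t) • y)) γ := fun y ↦ by
    obtain ⟨C, hC⟩ := hh.exists_bound
    have := hh.continuous
    exact Integrable.of_bound (by fun_prop : Continuous _).aestronglyMeasurable C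
      (ae_of_all _ fun z ↦ hC _)
  have hg0 : ∀ y, 0 ≤ g y := fun y ↦ integral_nonneg fun z ↦ h0 _
  have hg1 : ∀ y, g y ≤ 1 := fun y ↦ by
    have := integral_mono (hhi y) (integrable_const 1) fun z ↦ h1 _
    simpa using! this
  calc ∑ i, ∑ j, ∫ y, (V i j y) ^ 2 ∂γ ≤ ∑ i, ∫ y, U i y * G i y ∂γ :=
        Finset.sum_le_sum fun i _ ↦ sum_V_sq_le i
    _ = ∫ y, ∑ i, g y * (y i * U i y - V i i y) ∂γ := by
        simp_rw [integral_U_mul_G]; rw [integral_finsetSum _ fun i _ ↦ i3 i]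
    _ ≤ ∫ y, 1 ∂γ := by
        refine integral_mono (integrable_finsetSum _ fun i _ ↦ i3 i) (integrable_const _)
          fun y ↦ ?_
        simp only
        rw [← Finset.mul_sum]
        have e : ∑ i, (y i * U i y - V i i y) = g y - ∫ z, h z ∂γ :=
          stein_equation ht ht1 hh y
        -- The integrand is g(g − c), at most g² ≤ 1 because g ≥ 0 and c ≥ 0.
        have hc : 0 ≤ ∫ z, h z ∂γ := integral_nonneg h0
        rw [e]
        nlinarith [hg0 y, hg1 y]
    _ = 1 := by simp

end Bochner

/-! ### Gaussian-bounded kernels: moving derivatives from `h` to the density. -/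

section Kernel

variable {F : Type*} [NormedAddCommGroup F]

/-- Continuous kernels with a Gaussian bound. -/
def IsGaussKernel (ψ : Euc m → F) : Prop :=
  Continuous ψ ∧ ∃ K : ℝ, ∀ z, ‖ψ z‖ ≤ K * Real.exp (-(1 / 4) * ‖z‖ ^ 2)

lemma IsGaussKernel.integrable {ψ : Euc m → F} (hψ : IsGaussKernel ψ) : Integrable ψ := by
  obtain ⟨hc, K, hK⟩ := hψ
  exact ((integrable_exp_neg_mul_sq_norm (by norm_num)).const_mul K).mono'
    hc.aestronglyMeasurable (ae_of_all _ hK)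

/-- From ‖z‖² ≤ 2‖z - v‖² + 2‖v‖². Halving the exponent buys a bound uniform over translations in a
ball, as domination requires. -/
lemma exp_neg_sq_norm_sub_le (z v : Euc m) {R : ℝ} (hv : ‖v‖ ≤ R) :
    Real.exp (-(1 / 4) * ‖z - v‖ ^ 2) ≤
      Real.exp (R ^ 2 / 4) * Real.exp (-(1 / 8) * ‖z‖ ^ 2) := by
  rw [← Real.exp_add]
  apply Real.exp_le_exp.2
  have h1 : ‖z‖ ≤ ‖z - v‖ + ‖v‖ := by simpa using norm_add_le (z - v) v
  have h2 : ‖z‖ ^ 2 ≤ 2 * ‖z - v‖ ^ 2 + 2 * ‖v‖ ^ 2 := by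
    nlinarith [norm_nonneg z, sq_nonneg (‖z - v‖ - ‖v‖)]
  have h3 : ‖v‖ ^ 2 ≤ R ^ 2 := pow_le_pow_left₀ (norm_nonneg _) hv 2
  linarith

/-- A local integrable bound for the translates of a Gaussian kernel. -/
lemma IsGaussKernel.exists_dominating {ψ : Euc m → F} (hψ : IsGaussKernel ψ) (ρ : ℝ)
    (y₀ : Euc m) : ∃ G : Euc m → ℝ, Integrable G ∧
      ∀ z, ∀ y ∈ Metric.ball y₀ 1, ‖ψ (z - ρ • y)‖ ≤ G z := by
  obtain ⟨-, K, hK⟩ := hψ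
  have hK0 : 0 ≤ K := by
    have := (norm_nonneg _).trans (hK 0)
    simpa using this
  refine ⟨fun z ↦ K * (Real.exp ((|ρ| * (‖y₀‖ + 1)) ^ 2 / 4) * Real.exp (-(1 / 8) * ‖z‖ ^ 2)),
    ((integrable_exp_neg_mul_sq_norm (by norm_num)).const_mul _).const_mul _,
    fun z y hy ↦ (hK _).trans ?_⟩
  refine mul_le_mul_of_nonneg_left (exp_neg_sq_norm_sub_le z _ ?_) hK0
  rw [norm_smul, Real.norm_eq_abs]
  refine mul_le_mul_of_nonneg_left ?_ (abs_nonneg _)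
  have h1 : ‖y - y₀‖ < 1 := by simpa [dist_eq_norm] using hy
  have h2 : ‖y‖ ≤ ‖y - y₀‖ + ‖y₀‖ := by simpa using norm_add_le (y - y₀) y₀
  linarith

lemma one_add_mul_exp_le (x : ℝ) :
    (1 + x) * Real.exp (-(1 / 2) * x) ≤ 4 * Real.exp (-(1 / 4) * x) := by
  have h1 : 1 + x ≤ 4 * Real.exp (1 / 4 * x) := by
    have := Real.add_one_le_exp (1 / 4 * x)
    linarith
  calc (1 + x) * Real.exp (-(1 / 2) * x) ≤ 4 * Real.exp (1 / 4 * x) * Real.exp (-(1 / 2) * x) :=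
        mul_le_mul_of_nonneg_right h1 (Real.exp_pos _).le
    _ = 4 * Real.exp (-(1 / 4) * x) := by rw [mul_assoc, ← Real.exp_add]; ring_nf

/-- Half of the Gaussian exponent absorbs a quadratic factor; this covers the density and its first
two derivatives. -/
lemma isGaussKernel_of_le {ψ : Euc m → F} (hc : Continuous ψ)
    (hb : ∀ z, ‖ψ z‖ ≤ stdDensity z * (1 + ‖z‖ ^ 2)) : IsGaussKernel ψ := by
  refine ⟨hc, (Real.sqrt ((2 * Real.pi) ^ m))⁻¹ * 4, fun z ↦ (hb z).trans ?_⟩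
  rw [stdDensity_eq, mul_assoc, mul_assoc]
  refine mul_le_mul_of_nonneg_left ?_ (by positivity)
  rw [mul_comm]
  exact one_add_mul_exp_le _

variable [NormedSpace ℝ F]

section Translate

variable {b : Euc m → ℝ} {ψ : Euc m → F} {ρ : ℝ}

lemma aestronglyMeasurable_translate (hb : Measurable b) (hψ : Continuous ψ) (y : Euc m) :
    AEStronglyMeasurable (fun z ↦ b z • ψ (z - ρ • y)) :=
  hb.aestronglyMeasurable.smul (by fun_prop : Continuous fun z ↦ ψ (z - ρ • y)).aestronglyMeasurable

lemma norm_smul_le_of_abs_le_one {c : ℝ} (hc : |c| ≤ 1) (v : F) : ‖c • v‖ ≤ ‖v‖ := by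
  rw [norm_smul]; exact mul_le_of_le_one_left (norm_nonneg _) hc

lemma continuous_integral_translate (hb : Measurable b) (hb1 : ∀ z, |b z| ≤ 1)
    (hψ : IsGaussKernel ψ) : Continuous fun y ↦ ∫ z, b z • ψ (z - ρ • y) := by
  rw [continuous_iff_continuousAt]
  intro y₀
  obtain ⟨G, hG, hGb⟩ := hψ.exists_dominating ρ y₀
  have hc := hψ.1
  refine continuousAt_of_dominated (bound := G)
    (Eventually.of_forall fun y ↦ aestronglyMeasurable_translate hb hψ.1 y) ?_ hG
    (ae_of_all _ fun z ↦ by fun_prop)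
  filter_upwards [Metric.ball_mem_nhds y₀ one_pos] with y hy
  exact ae_of_all _ fun z ↦ (norm_smul_le_of_abs_le_one (hb1 z) _).trans (hGb z y hy)

lemma hasFDerivAt_integral_translate {ψ' : Euc m → Euc m →L[ℝ] F} (hb : Measurable b)
    (hb1 : ∀ z, |b z| ≤ 1) (hψ : IsGaussKernel ψ) (hψ' : IsGaussKernel ψ')
    (hd : ∀ z, HasFDerivAt ψ (ψ' z) z) (y₀ : Euc m) :
    HasFDerivAt (fun y ↦ ∫ z, b z • ψ (z - ρ • y))
      ((-ρ) • ∫ z, b z • ψ' (z - ρ • y₀)) y₀ := by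
  obtain ⟨G, hG, hGb⟩ := hψ.exists_dominating ρ y₀
  obtain ⟨G', hG', hGb'⟩ := hψ'.exists_dominating ρ y₀
  rw [← integral_smul]
  refine hasFDerivAt_integral_of_dominated_of_fderiv_le
    (F' := fun y z ↦ (-ρ) • (b z • ψ' (z - ρ • y))) (bound := fun z ↦ |ρ| * G' z)
    (Metric.ball_mem_nhds y₀ one_pos)
    (Eventually.of_forall fun y ↦ aestronglyMeasurable_translate hb hψ.1 y)
    (hG.mono' (aestronglyMeasurable_translate hb hψ.1 y₀)
      (ae_of_all _ fun z ↦ (norm_smul_le_of_abs_le_one (hb1 z) _).trans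
        (hGb z y₀ (Metric.mem_ball_self one_pos))))
    ((aestronglyMeasurable_translate hb hψ'.1 y₀).const_smul (-ρ))
    (ae_of_all _ fun z y hy ↦ ?_) (hG'.const_mul _) (ae_of_all _ fun z y _ ↦ ?_)
  · rw [norm_smul, norm_neg, Real.norm_eq_abs]
    exact mul_le_mul_of_nonneg_left
      ((norm_smul_le_of_abs_le_one (hb1 z) _).trans (hGb' z y hy)) (abs_nonneg _)
  · have h1 : HasFDerivAt (fun y : Euc m ↦ z - ρ • y) (-(ρ • ContinuousLinearMap.id ℝ (Euc m))) y :=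
      ((hasFDerivAt_id y).const_smul ρ).const_sub z
    have h2 := ((hd (z - ρ • y)).comp y h1).const_smul (b z)
    refine h2.congr_fderiv ?_
    ext v
    simp [smul_smul, mul_comm]

end Translate

/-- The average of `h(√s z + √(1-s) y)` against a kernel `ψ(z) dz`. -/
def kernelAvg (h : Euc m → ℝ) (ψ : Euc m → F) (s : ℝ) (y : Euc m) : F :=
  ∫ z, h (Real.sqrt s • z + Real.sqrt (1 - s) • y) • ψ z

section KernelAvg

variable {h : Euc m → ℝ} {ψ : Euc m → F} {s : ℝ}

/-- The ratio `√(1-s) / √s`. -/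
def sqrtRatio (s : ℝ) : ℝ := Real.sqrt (1 - s) / Real.sqrt s

/-- The shift of z by √(1-s)/√s · y moves y from the merely measurable h into the smooth kernel.
Each derivative in y then costs a factor −√(1-s)/√s. -/
lemma kernelAvg_eq_translate (hs : 0 < s) (y : Euc m) :
    kernelAvg h ψ s y = ∫ z, h (Real.sqrt s • z) • ψ (z - sqrtRatio s • y) := by
  rw [kernelAvg, ← integral_sub_right_eq_self _ (sqrtRatio s • y)]
  refine integral_congr_ae (ae_of_all _ fun z ↦ ?_)
  have hs' : Real.sqrt s ≠ 0 := (Real.sqrt_pos.2 hs).ne'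
  have : Real.sqrt s • (z - sqrtRatio s • y) + Real.sqrt (1 - s) • y = Real.sqrt s • z := by
    rw [smul_sub, smul_smul, sqrtRatio, mul_div_cancel₀ _ hs', sub_add_cancel]
  simp only [this]

lemma continuous_kernelAvg (hh : Measurable h) (hh1 : ∀ x, |h x| ≤ 1) (hψ : IsGaussKernel ψ)
    (hs : 0 < s) : Continuous (kernelAvg h ψ s) := by
  rw [funext fun y ↦ kernelAvg_eq_translate (h := h) (ψ := ψ) hs y]
  exact continuous_integral_translate (b := fun z ↦ h (Real.sqrt s • z)) (by fun_prop)
    (fun z ↦ hh1 _) hψ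

lemma hasFDerivAt_kernelAvg {ψ' : Euc m → Euc m →L[ℝ] F} (hh : Measurable h)
    (hh1 : ∀ x, |h x| ≤ 1) (hψ : IsGaussKernel ψ) (hψ' : IsGaussKernel ψ')
    (hd : ∀ z, HasFDerivAt ψ (ψ' z) z) (hs : 0 < s) (y : Euc m) :
    HasFDerivAt (kernelAvg h ψ s) ((-sqrtRatio s) • kernelAvg h ψ' s y) y := by
  rw [funext fun y ↦ kernelAvg_eq_translate (h := h) (ψ := ψ) hs y, kernelAvg_eq_translate hs]
  exact hasFDerivAt_integral_translate (b := fun z ↦ h (Real.sqrt s • z)) (by fun_prop)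
    (fun z ↦ hh1 _) hψ hψ' hd y

lemma integrable_smul_kernel (hh : Measurable h) (hh1 : ∀ x, |h x| ≤ 1) (hψ : Integrable ψ)
    (y : Euc m) : Integrable fun z ↦ h (Real.sqrt s • z + Real.sqrt (1 - s) • y) • ψ z :=
  hψ.mono ((by fun_prop : Measurable fun z : Euc m ↦
    h (Real.sqrt s • z + Real.sqrt (1 - s) • y)).aestronglyMeasurable.smul
      hψ.aestronglyMeasurable) (ae_of_all _ fun z ↦ norm_smul_le_of_abs_le_one (hh1 _) _)

lemma norm_kernelAvg_le (hh1 : ∀ x, |h x| ≤ 1) (hψ : Integrable ψ) (y : Euc m) :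
    ‖kernelAvg h ψ s y‖ ≤ ∫ z, ‖ψ z‖ :=
  norm_integral_le_of_norm_le hψ.norm
    (ae_of_all _ fun _ ↦ norm_smul_le_of_abs_le_one (hh1 _) _)

lemma stronglyMeasurable_kernelAvg (hh : Measurable h) (hψ : Continuous ψ) (y : Euc m) :
    StronglyMeasurable fun s ↦ kernelAvg h ψ s y := by
  refine StronglyMeasurable.integral_prod_right'
    (f := fun p : ℝ × Euc m ↦ h (Real.sqrt p.1 • p.2 + Real.sqrt (1 - p.1) • y) • ψ p.2) ?_
  have h1 : Measurable fun p : ℝ × Euc m ↦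
    h (Real.sqrt p.1 • p.2 + Real.sqrt (1 - p.1) • y) := by fun_prop
  exact h1.stronglyMeasurable.smul (by fun_prop : Continuous fun p : ℝ × Euc m ↦
    ψ p.2).stronglyMeasurable

/-- The weight 1/(1-s) is not integrable up to s = 1, so the undifferentiated integral needs the
centring c. Differentiation removes c and supplies `sqrtRatio s`, after which the weight alone is
integrable. -/
lemma hasFDerivAt_integral_kernelAvg {ψ' : Euc m → Euc m →L[ℝ] F} {t : ℝ} (ht : 0 < t)
    {w : ℝ → ℝ} {c : F} (hh : Measurable h) (hh1 : ∀ x, |h x| ≤ 1) (hψ : IsGaussKernel ψ)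
    (hψ' : IsGaussKernel ψ') (hd : ∀ z, HasFDerivAt ψ (ψ' z) z)
    (hi : ∀ y, IntegrableOn (fun s ↦ w s • (kernelAvg h ψ s y - c)) (Ioo t 1))
    (hr : IntegrableOn (fun s ↦ w s * sqrtRatio s) (Ioo t 1)) (y₀ : Euc m) :
    HasFDerivAt (fun y ↦ ∫ s in Ioo t 1, w s • (kernelAvg h ψ s y - c))
      (∫ s in Ioo t 1, (-(w s * sqrtRatio s)) • kernelAvg h ψ' s y₀) y₀ := by
  refine hasFDerivAt_integral_of_dominated_of_fderiv_le
    (F' := fun y s ↦ (-(w s * sqrtRatio s)) • kernelAvg h ψ' s y)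
    (bound := fun s ↦ |w s * sqrtRatio s| * ∫ z, ‖ψ' z‖) univ_mem
    (Eventually.of_forall fun y ↦ (hi y).aestronglyMeasurable) (hi y₀)
    (hr.neg.aestronglyMeasurable.smul
      (stronglyMeasurable_kernelAvg hh hψ'.1 y₀).aestronglyMeasurable)
    (ae_of_all _ fun s y _ ↦ ?_) (hr.abs.mul_const _) ?_
  · rw [norm_smul, norm_neg, Real.norm_eq_abs]
    exact mul_le_mul_of_nonneg_left (norm_kernelAvg_le hh1 hψ'.integrable y) (abs_nonneg _)
  · filter_upwards [ae_restrict_mem measurableSet_Ioo] with s hs y _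
    have h1 := ((hasFDerivAt_kernelAvg hh hh1 hψ hψ' hd (ht.trans hs.1) y).sub_const c).const_smul
      (w s)
    refine h1.congr_fderiv ?_
    rw [smul_smul, mul_neg]

lemma integrableOn_smul_kernelAvg {t : ℝ} {w : ℝ → ℝ} (hh : Measurable h)
    (hh1 : ∀ x, |h x| ≤ 1) (hψ : IsGaussKernel ψ) (hw : IntegrableOn w (Ioo t 1)) (y : Euc m) :
    IntegrableOn (fun s ↦ w s • kernelAvg h ψ s y) (Ioo t 1) := by
  refine Integrable.smul_bdd hw (∫ z, ‖ψ z‖)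
    (stronglyMeasurable_kernelAvg hh hψ.1 y).aestronglyMeasurable
    (ae_of_all _ fun s ↦ norm_kernelAvg_le hh1 hψ.integrable y)

lemma continuous_integral_kernelAvg {t : ℝ} (ht : 0 < t) {w : ℝ → ℝ} (hh : Measurable h)
    (hh1 : ∀ x, |h x| ≤ 1) (hψ : IsGaussKernel ψ) (hw : IntegrableOn w (Ioo t 1)) :
    Continuous fun y ↦ ∫ s in Ioo t 1, w s • kernelAvg h ψ s y := by
  refine continuous_of_dominated (bound := fun s ↦ |w s| * ∫ z, ‖ψ z‖)
    (fun y ↦ (integrableOn_smul_kernelAvg hh hh1 hψ hw y).aestronglyMeasurable)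
    (fun y ↦ ae_of_all _ fun s ↦ ?_) (hw.abs.mul_const _) ?_
  · rw [norm_smul, Real.norm_eq_abs]
    exact mul_le_mul_of_nonneg_left (norm_kernelAvg_le hh1 hψ.integrable y) (abs_nonneg _)
  · filter_upwards [ae_restrict_mem measurableSet_Ioo] with s hs
    exact (continuous_kernelAvg hh hh1 hψ (ht.trans hs.1)).const_smul _

end KernelAvg

/-! ### First and second derivatives of the Gaussian density. -/

section DensityDerivatives

set_option maxSynthPendingDepth 3

/-- The real inner product as a continuous bilinear map. -/
def innerL : Euc m →L[ℝ] Euc m →L[ℝ] ℝ :=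
  LinearMap.mkContinuous₂ (innerₗ (Euc m)) 1 fun x y ↦ by
    simpa using abs_real_inner_le_norm x y

lemma innerL_apply (x y : Euc m) : innerL x y = inner ℝ x y := rfl

lemma innerL_eq (x : Euc m) : innerL x = innerSL ℝ x := rfl

lemma norm_innerL_le : ‖(innerL : Euc m →L[ℝ] Euc m →L[ℝ] ℝ)‖ ≤ 1 :=
  LinearMap.mkContinuous₂_norm_le _ zero_le_one _

/-- The first derivative of the standard Gaussian density. -/
def stdDensity₁ (z : Euc m) : Euc m →L[ℝ] ℝ := -(stdDensity z) • innerL z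

/-- The second derivative of the standard Gaussian density. -/
def stdDensity₂ (z : Euc m) : Euc m →L[ℝ] Euc m →L[ℝ] ℝ :=
  stdDensity z • ((innerL z).smulRight (innerL z) - innerL)

lemma hasFDerivAt_stdDensity₁ (z : Euc m) :
    HasFDerivAt (stdDensity₁ (m := m)) (stdDensity₂ z) z := by
  have h1 : HasFDerivAt (fun z : Euc m ↦ innerL z) innerL z := innerL.hasFDerivAt
  have h := (hasFDerivAt_stdDensity z).neg.smul h1
  refine h.congr_fderiv ?_
  ext u v
  simp [stdDensity₂, innerL_apply]
  ring

lemma isGaussKernel_stdDensity : IsGaussKernel (stdDensity : Euc m → ℝ) :=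
  isGaussKernel_of_le continuous_stdDensity fun z ↦ by
    rw [Real.norm_eq_abs, abs_of_pos (stdDensity_pos z)]
    exact le_mul_of_one_le_right (stdDensity_pos z).le (by nlinarith [norm_nonneg z])

lemma isGaussKernel_stdDensity₁ : IsGaussKernel (stdDensity₁ (m := m)) := by
  have hc := continuous_stdDensity (m := m)
  refine isGaussKernel_of_le (by unfold stdDensity₁; fun_prop) fun z ↦ ?_
  rw [stdDensity₁, norm_smul, norm_neg, Real.norm_eq_abs, abs_of_pos (stdDensity_pos z),
    innerL_eq, innerSL_apply_norm]
  exact mul_le_mul_of_nonneg_left (by nlinarith [norm_nonneg z, sq_nonneg (‖z‖ - 1)])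
    (stdDensity_pos z).le

lemma continuous_smul_smulRight_sub {X E : Type*} [TopologicalSpace X] [NormedAddCommGroup E]
    [NormedSpace ℝ E] {c : X → ℝ} {L : X → E →L[ℝ] ℝ} (B : E →L[ℝ] E →L[ℝ] ℝ)
    (hc : Continuous c) (hL : Continuous L) :
    Continuous fun x ↦ c x • ((L x).smulRight (L x) - B) := by
  refine hc.smul (Continuous.sub ?_ continuous_const)
  exact ((ContinuousLinearMap.smulRightL ℝ E (E →L[ℝ] ℝ)).continuous₂).comp (hL.prodMk hL)

lemma norm_smul_smulRight_sub_le {E : Type*} [NormedAddCommGroup E]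
    [NormedSpace ℝ E] (c : ℝ) (L : E →L[ℝ] ℝ) (B : E →L[ℝ] E →L[ℝ] ℝ) :
    ‖c • (L.smulRight L - B)‖ ≤ |c| * (‖B‖ + ‖L‖ ^ 2) := by
  rw [norm_smul, Real.norm_eq_abs]
  refine mul_le_mul_of_nonneg_left ((norm_sub_le _ _).trans ?_) (abs_nonneg _)
  rw [ContinuousLinearMap.norm_smulRight_apply, sq, add_comm]

lemma isGaussKernel_stdDensity₂ : IsGaussKernel (stdDensity₂ (m := m)) := by
  refine isGaussKernel_of_le
    (continuous_smul_smulRight_sub _ continuous_stdDensity innerL.continuous) fun z ↦ ?_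
  refine (norm_smul_smulRight_sub_le (stdDensity z) (innerL z) innerL).trans ?_
  rw [abs_of_pos (stdDensity_pos z), innerL_eq, innerSL_apply_norm]
  exact mul_le_mul_of_nonneg_left (add_le_add norm_innerL_le le_rfl) (stdDensity_pos z).le

/-- The entries of the second derivative of the standard Gaussian density. -/
def densityHess (i j : Fin m) (z : Euc m) : ℝ := stdDensity₂ z (stdBasis i) (stdBasis j)

lemma densityHess_eq (i j : Fin m) (z : Euc m) :
    densityHess i j z = stdDensity z * (z i * z j - if i = j then 1 else 0) := by
  rw [densityHess, stdDensity₂]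
  simp [innerL_apply, inner_stdBasis]
  simp [eq_comm]

lemma partialDeriv_of_hasFDerivAt {f : Euc m → ℝ} {f' : Euc m →L[ℝ] ℝ} {y : Euc m}
    (hf : HasFDerivAt f f' y) (i : Fin m) : partialDeriv i f y = f' (stdBasis i) :=
  (hf.hasLineDerivAt _).lineDeriv

lemma partialDeriv₂_of_hasFDerivAt {f : Euc m → ℝ} {f' : Euc m → Euc m →L[ℝ] ℝ}
    {f'' : Euc m → Euc m →L[ℝ] Euc m →L[ℝ] ℝ} (hf : ∀ y, HasFDerivAt f (f' y) y)
    (hf' : ∀ y, HasFDerivAt f' (f'' y) y) (i j : Fin m) (y : Euc m) :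
    partialDeriv₂ i j f y = f'' y (stdBasis i) (stdBasis j) := by
  have h : partialDeriv j f = fun y ↦ f' y (stdBasis j) :=
    funext fun y ↦ partialDeriv_of_hasFDerivAt (hf y) j
  rw [partialDeriv₂, h]
  have := (hf' y).clm_apply (hasFDerivAt_const (stdBasis j) y)
  rw [partialDeriv_of_hasFDerivAt this]
  simp

lemma partialDeriv₂_stdDensity (i j : Fin m) (z : Euc m) :
    partialDeriv₂ i j (gaussianDensity (1 : Matrix (Fin m) (Fin m) ℝ)) z = densityHess i j z :=
  partialDeriv₂_of_hasFDerivAt (f := stdDensity) (fun y ↦ hasFDerivAt_stdDensity y)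
    hasFDerivAt_stdDensity₁ i j z

end DensityDerivatives

end Kernel

/-! ### Bounded measurable `h`, covariance I: convergence in `s` and two derivatives. -/

/-- Rotation invariance of the standard Gaussian measure. -/
lemma map_prod_stdGaussian {s : ℝ} (hs : s ∈ Icc (0 : ℝ) 1) :
    ((stdGaussian (Euc m)).prod (stdGaussian (Euc m))).map
      (fun p ↦ Real.sqrt s • p.1 + Real.sqrt (1 - s) • p.2) = stdGaussian (Euc m) := by
  have h1 : ∀ c : ℝ, IsProbabilityMeasure ((stdGaussian (Euc m)).map (c • ·)) := fun c ↦
    Measure.isProbabilityMeasure_map (by fun_prop)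
  have h2 : ((stdGaussian (Euc m)).prod (stdGaussian (Euc m))).map
      (fun p ↦ Real.sqrt s • p.1 + Real.sqrt (1 - s) • p.2) =
      (((stdGaussian (Euc m)).map (Real.sqrt s • ·)).prod
        ((stdGaussian (Euc m)).map (Real.sqrt (1 - s) • ·))).map (fun p ↦ p.1 + p.2) := by
    rw [Measure.map_prod_map _ _ (by fun_prop) (by fun_prop),
      Measure.map_map (by fun_prop) (by fun_prop)]
    rfl
  have := Measure.isProbabilityMeasure_map
    (μ := (stdGaussian (Euc m)).prod (stdGaussian (Euc m)))
    (f := fun p ↦ Real.sqrt s • p.1 + Real.sqrt (1 - s) • p.2) (by fun_prop)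
  apply Measure.ext_of_charFun
  have e1 : Real.sqrt s ^ 2 = s := Real.sq_sqrt hs.1
  have e2 : Real.sqrt (1 - s) ^ 2 = 1 - s := Real.sq_sqrt (by linarith [hs.2])
  ext t
  rw [h2, charFun_map_add_prod_eq_mul, Pi.mul_apply, charFun_map_smul, charFun_map_smul,
    charFun_stdGaussian, charFun_stdGaussian, charFun_stdGaussian, ← Complex.exp_add]
  congr 1
  rw [norm_smul, norm_smul, Real.norm_eq_abs, Real.norm_eq_abs,
    abs_of_nonneg (Real.sqrt_nonneg _), abs_of_nonneg (Real.sqrt_nonneg _)]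
  have e1' : (Real.sqrt s : ℂ) ^ 2 = s := by exact_mod_cast e1
  have e2' : (Real.sqrt (1 - s) : ℂ) ^ 2 = 1 - s := by exact_mod_cast e2
  push_cast
  rw [mul_pow, mul_pow, e1', e2']
  ring

section Bounded

set_option maxSynthPendingDepth 3

variable {h : Euc m → ℝ} {t s : ℝ}

lemma kernelAvg_stdDensity (h : Euc m → ℝ) (s : ℝ) (y : Euc m) :
    kernelAvg h stdDensity s y =
      ∫ z, h (Real.sqrt s • z + Real.sqrt (1 - s) • y) ∂(stdGaussian (Euc m)) := by
  rw [kernelAvg, integral_stdGaussian]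
  simp_rw [smul_eq_mul, mul_comm]

lemma integral_kernelAvg_stdDensity (hh : Measurable h) (hh1 : ∀ x, |h x| ≤ 1)
    (hs : s ∈ Icc (0 : ℝ) 1) :
    ∫ y, kernelAvg h stdDensity s y ∂(stdGaussian (Euc m)) =
      ∫ z, h z ∂(stdGaussian (Euc m)) := by
  conv_rhs => rw [← map_prod_stdGaussian (m := m) hs]
  rw [integral_map (by fun_prop) hh.aestronglyMeasurable, integral_prod_symm]
  · simp_rw [kernelAvg_stdDensity]
  · exact Integrable.of_bound (by fun_prop : Measurable _).aestronglyMeasurable 1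
      (ae_of_all _ fun p ↦ hh1 _)

/-- The total mass of the first derivative of the Gaussian density. -/
def densityVariation (m : ℕ) : ℝ := ∫ z : Euc m, ‖stdDensity₁ z‖

lemma sqrtRatio_nonneg (s : ℝ) : 0 ≤ sqrtRatio s := by unfold sqrtRatio; positivity

lemma abs_kernelAvg_sub_le (hh : Measurable h) (hh1 : ∀ x, |h x| ≤ 1) (hs : 0 < s)
    (x y : Euc m) : |kernelAvg h stdDensity s x - kernelAvg h stdDensity s y| ≤
      sqrtRatio s * densityVariation m * ‖x - y‖ := by
  have hd := fun y ↦ hasFDerivAt_kernelAvg hh hh1 isGaussKernel_stdDensity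
    isGaussKernel_stdDensity₁ (fun z ↦ hasFDerivAt_stdDensity z) hs y
  refine Convex.norm_image_sub_le_of_norm_hasFDerivWithin_le (s := univ)
    (fun y _ ↦ (hd y).hasFDerivWithinAt) (fun y _ ↦ ?_) convex_univ (mem_univ _) (mem_univ _)
  rw [norm_smul, norm_neg, Real.norm_eq_abs, abs_of_nonneg (sqrtRatio_nonneg s)]
  exact mul_le_mul_of_nonneg_left (norm_kernelAvg_le hh1 isGaussKernel_stdDensity₁.integrable y)
    (sqrtRatio_nonneg s)

/-- By rotation invariance the mean of h is the γ-average of the kernel average itself, so the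
difference is an average of increments of a Lipschitz function. The Lipschitz factor, of order
√(1-s), tames 1/(1-s) at s = 1. -/
lemma abs_kernelAvg_sub_mean_le (hh : Measurable h) (hh1 : ∀ x, |h x| ≤ 1)
    (hs : s ∈ Ioo (0 : ℝ) 1) (y : Euc m) :
    |kernelAvg h stdDensity s y - ∫ z, h z ∂(stdGaussian (Euc m))| ≤
      sqrtRatio s * (densityVariation m * ∫ x, ‖y - x‖ ∂(stdGaussian (Euc m))) := by
  have hint : Integrable (kernelAvg h stdDensity s) (stdGaussian (Euc m)) :=
    Integrable.of_bound (continuous_kernelAvg hh hh1 isGaussKernel_stdDensity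
      hs.1).aestronglyMeasurable _
      (ae_of_all _ fun y ↦ norm_kernelAvg_le hh1 isGaussKernel_stdDensity.integrable y)
  have hn : Integrable (fun x : Euc m ↦ ‖y - x‖) (stdGaussian (Euc m)) :=
    ((integrable_const y).sub IsGaussian.integrable_id).norm
  rw [← integral_kernelAvg_stdDensity hh hh1 ⟨hs.1.le, hs.2.le⟩]
  have e : kernelAvg h stdDensity s y - ∫ x, kernelAvg h stdDensity s x ∂(stdGaussian (Euc m)) =
      ∫ x, (kernelAvg h stdDensity s y - kernelAvg h stdDensity s x) ∂(stdGaussian (Euc m)) := by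
    rw [integral_sub (integrable_const _) hint]; simp
  rw [e, ← mul_assoc, ← integral_const_mul, ← Real.norm_eq_abs]
  exact norm_integral_le_of_norm_le (hn.const_mul _)
    (ae_of_all _ fun x ↦ abs_kernelAvg_sub_le hh hh1 hs.1 y x)

lemma steinIntegrand_one (hh : Measurable h) (hh1 : ∀ x, |h x| ≤ 1) (y : Euc m) (s : ℝ) :
    steinIntegrand h 1 y s =
      1 / (1 - s) * (kernelAvg h stdDensity s y - ∫ z, h z ∂(stdGaussian (Euc m))) := by
  have h1 := integrable_smul_kernel (s := s) hh hh1 integrable_stdDensity y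
  have h2 : Integrable fun z ↦ h z * stdDensity z :=
    integrable_stdDensity.bdd_mul (c := 1) hh.aestronglyMeasurable (ae_of_all _ hh1)
  rw [steinIntegrand, kernelAvg, integral_stdGaussian]
  simp_rw [sub_mul, smul_eq_mul] at h1 ⊢
  rw [integral_sub h1 h2]
  simp_rw [mul_comm (stdDensity _)]

lemma inv_mul_sqrtRatio (hs : s ∈ Ioo (0 : ℝ) 1) :
    1 / (1 - s) * sqrtRatio s = rootWeight s * (2 / Real.sqrt s) := by
  have h1 : 0 < 1 - s := by linarith [hs.2]
  have h2 : Real.sqrt (1 - s) ≠ 0 := (Real.sqrt_pos.2 h1).ne'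
  have h3 : Real.sqrt s ≠ 0 := (Real.sqrt_pos.2 hs.1).ne'
  rw [sqrtRatio, rootWeight]
  nth_rewrite 1 [← Real.sq_sqrt h1.le]
  field_simp

lemma integrableOn_inv_mul_sqrtRatio (ht : t ∈ Ioo (0 : ℝ) 1) :
    IntegrableOn (fun s ↦ 1 / (1 - s) * sqrtRatio s) (Ioo t 1) := by
  have h1 : IntegrableOn (fun s ↦ rootWeight s * (2 / Real.sqrt s)) (Ioo t 1) := by
    refine Integrable.mul_bdd (c := 2 / Real.sqrt t) (integrableOn_rootWeight ht.2)
      (by fun_prop : Measurable _).aestronglyMeasurable ?_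
    filter_upwards [ae_restrict_mem measurableSet_Ioo] with s hs
    rw [Real.norm_eq_abs, abs_of_nonneg (by positivity)]
    have := Real.sqrt_pos.2 ht.1
    have := Real.sqrt_le_sqrt hs.1.le
    gcongr
  refine h1.congr_fun (fun s hs ↦ ?_) measurableSet_Ioo
  exact (inv_mul_sqrtRatio ⟨ht.1.trans hs.1, hs.2⟩).symm

/-- After two derivatives the singularity at s = 1 is gone. The remaining weight 1/s integrates to
−log t over (t, 1). -/
lemma inv_mul_sqrtRatio_mul (hs : s ∈ Ioo (0 : ℝ) 1) :
    1 / (1 - s) * sqrtRatio s * sqrtRatio s = 1 / s := by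
  have h1 : 0 < 1 - s := by linarith [hs.2]
  have h0 := hs.1.ne'
  rw [sqrtRatio, mul_assoc, div_mul_div_comm, Real.mul_self_sqrt h1.le, Real.mul_self_sqrt hs.1.le]
  field_simp

lemma integrableOn_inv (ht : t ∈ Ioo (0 : ℝ) 1) : IntegrableOn (fun s ↦ 1 / s) (Ioo t 1) := by
  refine Integrable.of_bound (C := 1 / t) (by fun_prop : Measurable _).aestronglyMeasurable ?_
  filter_upwards [ae_restrict_mem measurableSet_Ioo] with s hs
  have h0 := ht.1
  rw [Real.norm_eq_abs, abs_of_nonneg (by have := h0.trans hs.1; positivity)]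
  exact one_div_le_one_div_of_le h0 hs.1.le

lemma integrableOn_kernelAvg_sub_mean (ht : t ∈ Ioo (0 : ℝ) 1) (hh : Measurable h)
    (hh1 : ∀ x, |h x| ≤ 1) (y : Euc m) :
    IntegrableOn (fun s ↦ (1 / (1 - s)) • (kernelAvg h stdDensity s y -
      ∫ z, h z ∂(stdGaussian (Euc m)))) (Ioo t 1) := by
  refine ((integrableOn_inv_mul_sqrtRatio ht).mul_const
    (densityVariation m * ∫ x, ‖y - x‖ ∂(stdGaussian (Euc m)))).mono' ?_ ?_
  · exact (by fun_prop : Measurable fun s : ℝ ↦ 1 / (1 - s)).aestronglyMeasurable.smul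
      ((stronglyMeasurable_kernelAvg hh continuous_stdDensity y).sub
        stronglyMeasurable_const).aestronglyMeasurable
  · filter_upwards [ae_restrict_mem measurableSet_Ioo] with s hs
    have hs1 : 0 < 1 - s := by linarith [hs.2]
    rw [norm_smul, Real.norm_eq_abs, Real.norm_eq_abs, abs_of_nonneg (by positivity), mul_assoc]
    exact mul_le_mul_of_nonneg_left
      (abs_kernelAvg_sub_mean_le hh hh1 ⟨ht.1.trans hs.1, hs.2⟩ y) (by positivity)

lemma intervalIntegrable_steinIntegrand_one (ht : t ∈ Ioo (0 : ℝ) 1) (hh : Measurable h)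
    (hh1 : ∀ x, |h x| ≤ 1) (y : Euc m) :
    IntervalIntegrable (steinIntegrand h 1 y) volume t 1 := by
  rw [intervalIntegrable_iff_integrableOn_Ioo_of_le ht.2.le]
  refine (integrableOn_kernelAvg_sub_mean ht hh hh1 y).congr_fun (fun s _ ↦ ?_) measurableSet_Ioo
  exact (steinIntegrand_one hh hh1 y s).symm

/-- The kernel formula for the second partial derivatives of the Stein solution. -/
def steinHess (t : ℝ) (h : Euc m → ℝ) (i j : Fin m) (y : Euc m) : ℝ :=
  1 / 2 * ∫ s in Ioo t 1, 1 / s * kernelAvg h (densityHess i j) s y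

lemma kernelAvg_stdDensity₂_apply (hh : Measurable h) (hh1 : ∀ x, |h x| ≤ 1) (y : Euc m)
    (u v : Euc m) :
    kernelAvg h stdDensity₂ s y u v = kernelAvg h (fun z ↦ stdDensity₂ z u v) s y := by
  have h1 := integrable_smul_kernel (s := s) hh hh1
    (isGaussKernel_stdDensity₂ (m := m)).integrable y
  rw [kernelAvg, ContinuousLinearMap.integral_apply h1,
    ContinuousLinearMap.integral_apply (h1.apply_continuousLinearMap u)]
  rfl

/-- Two differentiations under the time integral, with successive weights 1/(1-s), −r/(1-s) and
r²/(1-s) = 1/s, where r = √(1-s)/√s. -/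
theorem steinSolution_one_spec (ht : t ∈ Ioo (0 : ℝ) 1) (hh : Measurable h)
    (hh1 : ∀ x, |h x| ≤ 1) :
    ∃ (f' : Euc m → Euc m →L[ℝ] ℝ) (f'' : Euc m → Euc m →L[ℝ] Euc m →L[ℝ] ℝ),
      (∀ y, HasFDerivAt (steinSolution t h 1) (f' y) y) ∧ (∀ y, HasFDerivAt f' (f'' y) y) ∧
      Continuous f'' ∧ ∀ i j y, f'' y (stdBasis i) (stdBasis j) = steinHess t h i j y := by
  set c := ∫ z, h z ∂(stdGaussian (Euc m)) with hc
  have e0 : steinSolution t h 1 = fun y ↦ (1 / 2 : ℝ) • ∫ s in Ioo t 1,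
      (1 / (1 - s)) • (kernelAvg h stdDensity s y - c) := by
    ext y
    rw [steinSolution, intervalIntegral.integral_of_le ht.2.le, integral_Ioc_eq_integral_Ioo]
    simp_rw [steinIntegrand_one hh hh1, smul_eq_mul, hc]
  have hw1 := integrableOn_inv_mul_sqrtRatio ht
  have e1 : EqOn (fun s ↦ 1 / s) (fun s ↦ -(-(1 / (1 - s) * sqrtRatio s) * sqrtRatio s))
      (Ioo t 1) := fun s hs ↦ by
    have := inv_mul_sqrtRatio_mul ⟨ht.1.trans hs.1, hs.2⟩
    simp only
    rw [neg_mul, neg_neg, this]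
  have hw2 : IntegrableOn (fun s ↦ -(1 / (1 - s) * sqrtRatio s) * sqrtRatio s) (Ioo t 1) := by
    have := ((integrableOn_inv ht).congr_fun e1 measurableSet_Ioo).neg
    refine this.congr (ae_of_all _ fun s ↦ ?_)
    simp
  have hd1 := hasFDerivAt_integral_kernelAvg ht.1 (w := fun s ↦ 1 / (1 - s)) (c := c) hh hh1
    isGaussKernel_stdDensity isGaussKernel_stdDensity₁ (fun z ↦ hasFDerivAt_stdDensity z)
    (integrableOn_kernelAvg_sub_mean ht hh hh1) hw1
  -- The weight is now integrable by itself, so the second differentiation uses the centring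
  -- constant 0.
  have hi : ∀ y : Euc m, IntegrableOn (fun s ↦ (-(1 / (1 - s) * sqrtRatio s)) •
      (kernelAvg h stdDensity₁ s y - (0 : Euc m →L[ℝ] ℝ))) (Ioo t 1) := fun y ↦ by
    simpa only [sub_zero] using!
      integrableOn_smul_kernelAvg hh hh1 isGaussKernel_stdDensity₁ hw1.neg y
  have hd2 := hasFDerivAt_integral_kernelAvg ht.1 (w := fun s ↦ -(1 / (1 - s) * sqrtRatio s))
    (c := (0 : Euc m →L[ℝ] ℝ)) hh hh1
    isGaussKernel_stdDensity₁ isGaussKernel_stdDensity₂ hasFDerivAt_stdDensity₁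
    hi hw2
  simp_rw [sub_zero] at hd2
  have e2 : ∀ y : Euc m, ∫ s in Ioo t 1, (-(-(1 / (1 - s) * sqrtRatio s) * sqrtRatio s)) •
      kernelAvg h stdDensity₂ s y = ∫ s in Ioo t 1, (1 / s) • kernelAvg h stdDensity₂ s y :=
    fun y ↦ setIntegral_congr_fun measurableSet_Ioo fun s hs ↦
      congrArg (· • kernelAvg h stdDensity₂ s y) (e1 hs).symm
  simp_rw [e2] at hd2
  refine ⟨_, _, fun y ↦ ?_, fun y ↦ (hd2 y).const_smul (1 / 2 : ℝ), ?_, fun i j y ↦ ?_⟩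
  · rw [e0]
    exact (hd1 y).const_smul (1 / 2 : ℝ)
  · exact (continuous_integral_kernelAvg ht.1 hh hh1 isGaussKernel_stdDensity₂
      (integrableOn_inv ht)).const_smul (1 / 2 : ℝ)
  · have h1 := integrableOn_smul_kernelAvg hh hh1 (isGaussKernel_stdDensity₂ (m := m))
      (integrableOn_inv ht) y
    simp only [smul_apply]
    rw [ContinuousLinearMap.integral_apply h1,
      ContinuousLinearMap.integral_apply (h1.apply_continuousLinearMap _)]
    simp only [smul_apply, smul_eq_mul, steinHess,
      kernelAvg_stdDensity₂_apply hh hh1]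
    rfl

end Bounded

/-! ### Agreement of the two Hessian formulas, and smooth approximation of indicators. -/

/-- Integration by parts of a bounded function against an integrable kernel. -/
lemma integral_mul_lineDeriv_kernel {G G' k k' : Euc m → ℝ} {v : Euc m} (hG : IsBddCont G)
    (hG' : IsBddCont G') (hk : Integrable k) (hk' : Integrable k')
    (hd : ∀ x, HasLineDerivAt ℝ G (G' x) x v) (hdk : ∀ x, HasLineDerivAt ℝ k (k' x) x v) :
    ∫ x, G x * k' x = -∫ x, G' x * k x := by
  obtain ⟨hG, C, hC⟩ := hG
  obtain ⟨hG', C', hC'⟩ := hG'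
  exact integral_bilinear_hasLineDerivAt_right_eq_neg_left_of_integrable
    (B := ContinuousLinearMap.mul ℝ ℝ)
    (hk.bdd_mul (c := C') hG'.aestronglyMeasurable (ae_of_all _ hC'))
    (hk'.bdd_mul (c := C) hG.aestronglyMeasurable (ae_of_all _ hC))
    (hk.bdd_mul (c := C) hG.aestronglyMeasurable (ae_of_all _ hC))
    (fun x _ ↦ hd x) (fun x _ ↦ hdk x)

lemma hasLineDerivAt_comp_affine {F : Euc m → ℝ} (hF : IsTest F) (a : ℝ) (c : Euc m) (j : Fin m)
    (x : Euc m) :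
    HasLineDerivAt ℝ (fun z ↦ F (a • z + c)) (a * dir j F (a • x + c)) x (stdBasis j) := by
  have h1 : HasFDerivAt (fun z : Euc m ↦ F (a • z + c)) _ x :=
    (hF.differentiable (a • x + c)).hasFDerivAt.comp x
      (((hasFDerivAt_id x).const_smul a).add_const c)
  have := h1.hasLineDerivAt (stdBasis j)
  simpa [dir] using this

lemma isBddCont_comp_affine {F : Euc m → ℝ} (hF : IsTest F) (a b : ℝ) (c : Euc m) :
    IsBddCont fun z ↦ b * F (a • z + c) := by
  obtain ⟨C, hC⟩ := hF.exists_bound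
  have := hF.continuous
  refine ⟨by fun_prop, |b| * C, fun x ↦ ?_⟩
  rw [abs_mul]
  exact mul_le_mul_of_nonneg_left (hC _) (abs_nonneg _)

lemma integrable_stdDensity₁_apply (v : Euc m) : Integrable fun z : Euc m ↦ stdDensity₁ z v :=
  isGaussKernel_stdDensity₁.integrable.apply_continuousLinearMap v

lemma integrable_densityHess (i j : Fin m) : Integrable (densityHess i j) :=
  ((isGaussKernel_stdDensity₂ (m := m)).integrable.apply_continuousLinearMap
    (stdBasis i)).apply_continuousLinearMap (stdBasis j)

lemma continuous_densityHess (i j : Fin m) : Continuous (densityHess i j) :=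
  ((isGaussKernel_stdDensity₂ (m := m)).1.clm_apply continuous_const).clm_apply continuous_const

/-- Two integrations by parts return the derivatives to F; the signs cancel and each step yields √s.
The resulting s cancels the weight 1/s, which identifies the kernel Hessian with the one in the
Bochner argument. -/
lemma kernelAvg_densityHess {F : Euc m → ℝ} (hF : IsTest F) {s : ℝ} (hs : 0 < s) (i j : Fin m)
    (y : Euc m) : kernelAvg F (densityHess i j) s y = s * ouMean s (dir j (dir i F)) y := by
  set c := Real.sqrt (1 - s) • y with hc
  have h1 := integral_mul_lineDeriv_kernel (k' := densityHess i j)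
    (k := fun z ↦ stdDensity₁ z (stdBasis j)) (v := stdBasis i)
    (by simpa using isBddCont_comp_affine hF (Real.sqrt s) 1 c)
    (isBddCont_comp_affine (hF.dir i) (Real.sqrt s) (Real.sqrt s) c)
    (integrable_stdDensity₁_apply _) (integrable_densityHess i j)
    (hasLineDerivAt_comp_affine hF (Real.sqrt s) c i) (fun x ↦ by
      have := (hasFDerivAt_stdDensity₁ x).clm_apply (hasFDerivAt_const (stdBasis j) x)
      have := this.hasLineDerivAt (stdBasis i)
      simpa [densityHess] using this)
  have h2 := integral_mul_lineDeriv_kernel (k' := fun z ↦ stdDensity₁ z (stdBasis j))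
    (k := stdDensity) (v := stdBasis j)
    (by simpa using isBddCont_comp_affine (hF.dir i) (Real.sqrt s) 1 c)
    (isBddCont_comp_affine ((hF.dir i).dir j) (Real.sqrt s) (Real.sqrt s) c)
    integrable_stdDensity (integrable_stdDensity₁_apply _)
    (hasLineDerivAt_comp_affine (hF.dir i) (Real.sqrt s) c j)
    (fun x ↦ (hasFDerivAt_stdDensity x).hasLineDerivAt _)
  simp_rw [mul_assoc] at h1 h2
  rw [integral_const_mul] at h1 h2
  rw [kernelAvg, ouMean, integral_stdGaussian]
  simp_rw [smul_eq_mul, ← hc]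
  rw [h1, h2, mul_neg, neg_neg, ← mul_assoc, Real.mul_self_sqrt hs.le]
  simp_rw [mul_comm (stdDensity _)]

lemma steinHess_eq_timeAvg {t : ℝ} (ht : t ∈ Ioo (0 : ℝ) 1) {F : Euc m → ℝ} (hF : IsTest F)
    (i j : Fin m) (y : Euc m) :
    steinHess t F i j y = timeAvg t halfWeight (dir j (dir i F)) y := by
  rw [(timeAvg_eq (integrableOn_halfWeight ht.1 ht.2) ((hF.dir i).dir j) y).2, steinHess,
    ← integral_const_mul]
  refine setIntegral_congr_fun measurableSet_Ioo fun s hs ↦ ?_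
  have hs0 : 0 < s := ht.1.trans hs.1
  rw [kernelAvg_densityHess hF hs0, halfWeight_eq hs.2]
  field_simp

/-- Indicator functions of closed sets are pointwise limits of test functions. -/
lemma exists_test_tendsto_indicator {A : Set (Euc m)} (hA : IsClosed A) :
    ∃ F : ℕ → Euc m → ℝ, (∀ n, IsTest (F n)) ∧ (∀ n x, 0 ≤ F n x) ∧ (∀ n x, F n x ≤ 1) ∧
      ∀ x, Tendsto (fun n ↦ F n x) atTop (𝓝 (indicator A (fun _ ↦ 1) x)) := by
  -- As f vanishes exactly on A and takes values in [0, 1], the powers (1 - f)^n decrease to the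
  -- indicator of A. Growing bump functions χ_n provide compact support.
  obtain ⟨f, hfs, hf, hfr⟩ := hA.isOpen_compl.exists_contDiff_support_eq (n := ⊤)
  have hf01 : ∀ x, 0 ≤ f x ∧ f x ≤ 1 := fun x ↦ hfr (mem_range_self x)
  let χ : ℕ → ContDiffBump (0 : Euc m) := fun n ↦
    ⟨(n : ℝ) + 1, (n : ℝ) + 2, by positivity, by linarith⟩
  have hp : ∀ n x, 0 ≤ (1 - f x) ^ n ∧ (1 - f x) ^ n ≤ 1 := fun n x ↦
    ⟨pow_nonneg (by linarith [(hf01 x).2]) n,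
      pow_le_one₀ (by linarith [(hf01 x).2]) (by linarith [(hf01 x).1])⟩
  refine ⟨fun n x ↦ (1 - f x) ^ n * χ n x, fun n ↦ ⟨?_, ?_⟩, fun n x ↦ ?_, fun n x ↦ ?_,
    fun x ↦ ?_⟩
  · exact ((contDiff_const.sub hf).pow n).mul (χ n).contDiff
  · exact (χ n).hasCompactSupport.mul_left
  · exact mul_nonneg (hp n x).1 (χ n).nonneg
  · exact mul_le_one₀ (hp n x).2 (χ n).nonneg (χ n).le_one
  · by_cases hx : x ∈ A
    · have hfx : f x = 0 := by
        by_contra hne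
        have : x ∈ Aᶜ := hfs ▸ (Function.mem_support.2 hne)
        exact this hx
      rw [indicator_of_mem hx]
      refine tendsto_const_nhds.congr' ?_
      obtain ⟨N, hN⟩ := exists_nat_ge ‖x‖
      filter_upwards [eventually_ge_atTop N] with n hn
      have : x ∈ Metric.closedBall (0 : Euc m) (χ n).rIn := by
        rw [mem_closedBall_zero_iff]
        have : (N : ℝ) ≤ n := by exact_mod_cast hn
        change ‖x‖ ≤ (n : ℝ) + 1
        linarith
      rw [(χ n).one_of_mem_closedBall this, hfx]
      simp
    · have hfx : 0 < f x := by
        have : x ∈ Function.support f := hfs ▸ hx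
        exact lt_of_le_of_ne (hf01 x).1 (Ne.symm this)
      rw [indicator_of_notMem hx]
      refine squeeze_zero (fun n ↦ mul_nonneg (hp n x).1 (χ n).nonneg)
        (fun n ↦ mul_le_of_le_one_right (hp n x).1 (χ n).le_one)
        (tendsto_pow_atTop_nhds_zero_of_lt_one (by linarith [(hf01 x).2]) (by linarith))

/-! ### Passage to the limit: the Gaussian bound for closed sets. -/

section Limit

variable {t : ℝ} {h : Euc m → ℝ} {F : ℕ → Euc m → ℝ}

lemma abs_one_div_mul_kernelAvg_le (hh1 : ∀ x, |h x| ≤ 1) {s : ℝ} (hs : 0 < s) (i j : Fin m)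
    (y : Euc m) :
    |1 / s * kernelAvg h (densityHess i j) s y| ≤ 1 / s * ∫ z, |densityHess i j z| := by
  rw [abs_mul, abs_of_pos (by positivity : 0 < 1 / s)]
  exact mul_le_mul_of_nonneg_left (norm_kernelAvg_le hh1 (integrable_densityHess i j) y)
    (by positivity)

lemma abs_steinHess_le (ht : t ∈ Ioo (0 : ℝ) 1) (hh1 : ∀ x, |h x| ≤ 1) (i j : Fin m)
    (y : Euc m) :
    |steinHess t h i j y| ≤
      1 / 2 * ∫ s in Ioo t 1, 1 / s * ∫ z, |densityHess i j z| := by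
  rw [steinHess, abs_mul, abs_of_pos (by norm_num : (0 : ℝ) < 1 / 2)]
  refine mul_le_mul_of_nonneg_left ?_ (by norm_num)
  rw [← Real.norm_eq_abs]
  refine norm_integral_le_of_norm_le ((integrableOn_inv ht).mul_const _) ?_
  filter_upwards [ae_restrict_mem measurableSet_Ioo] with s hs
  exact abs_one_div_mul_kernelAvg_le hh1 (ht.1.trans hs.1) i j y

/-- In the kernel form h is never differentiated, so pointwise convergence with |h| ≤ 1 suffices:
dominated convergence applies in z and then in s. -/
lemma tendsto_steinHess (ht : t ∈ Ioo (0 : ℝ) 1) (hF : ∀ n, Measurable (F n))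
    (hF1 : ∀ n x, |F n x| ≤ 1) (hlim : ∀ x, Tendsto (fun n ↦ F n x) atTop (𝓝 (h x)))
    (i j : Fin m) (y : Euc m) :
    Tendsto (fun n ↦ steinHess t (F n) i j y) atTop (𝓝 (steinHess t h i j y)) := by
  refine Tendsto.const_mul _ (tendsto_integral_of_dominated_convergence
    (fun s ↦ 1 / s * ∫ z, |densityHess i j z|) (fun n ↦ ?_) ((integrableOn_inv ht).mul_const _)
    (fun n ↦ ?_) (ae_of_all _ fun s ↦ Tendsto.const_mul _ ?_))
  · exact (by fun_prop : Measurable fun s : ℝ ↦ 1 / s).aestronglyMeasurable.mul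
      (stronglyMeasurable_kernelAvg (hF n) (continuous_densityHess i j) y).aestronglyMeasurable
  · filter_upwards [ae_restrict_mem measurableSet_Ioo] with s hs
    exact abs_one_div_mul_kernelAvg_le (hF1 n) (ht.1.trans hs.1) i j y
  · exact tendsto_integral_of_dominated_convergence (fun z ↦ |densityHess i j z|)
      (fun n ↦ (integrable_smul_kernel (hF n) (hF1 n)
        (integrable_densityHess i j) y).aestronglyMeasurable)
      (integrable_densityHess i j).abs
      (fun n ↦ ae_of_all _ fun z ↦ norm_smul_le_of_abs_le_one (hF1 n _) _)
      (ae_of_all _ fun z ↦ (hlim _).smul_const _)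

lemma measurable_steinHess (ht : t ∈ Ioo (0 : ℝ) 1) (hh : Measurable h) (hh1 : ∀ x, |h x| ≤ 1)
    (i j : Fin m) : Measurable (steinHess t h i j) := by
  obtain ⟨f', f'', -, -, hc, he⟩ := steinSolution_one_spec ht hh hh1
  rw [← funext (he i j)]
  exact ((hc.clm_apply continuous_const).clm_apply continuous_const).measurable

lemma integrable_steinHess_sq (ht : t ∈ Ioo (0 : ℝ) 1) (hh : Measurable h)
    (hh1 : ∀ x, |h x| ≤ 1) (i j : Fin m) (ν : Measure (Euc m)) [IsFiniteMeasure ν] :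
    Integrable (fun y ↦ (steinHess t h i j y) ^ 2) ν :=
  Integrable.of_bound ((measurable_steinHess ht hh hh1 i j).pow_const 2).aestronglyMeasurable
    ((1 / 2 * ∫ s in Ioo t 1, 1 / s * ∫ z, |densityHess i j z|) ^ 2) (ae_of_all _ fun y ↦ by
      rw [Real.norm_eq_abs, abs_pow]
      exact pow_le_pow_left₀ (abs_nonneg _) (abs_steinHess_le ht hh1 i j y) 2)

/-- The Hessian of the Stein solution of the indicator of a closed set is bounded in `L²` of the
standard Gaussian measure. -/
theorem sum_integral_steinHess_sq_le (ht : t ∈ Ioo (0 : ℝ) 1) {A : Set (Euc m)}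
    (hA : IsClosed A) :
    ∑ i, ∑ j, ∫ y, (steinHess t (indicator A fun _ ↦ 1) i j y) ^ 2 ∂(stdGaussian (Euc m)) ≤ 1 := by
  obtain ⟨F, hF, h0, h1, hlim⟩ := exists_test_tendsto_indicator hA
  have hF1 : ∀ n x, |F n x| ≤ 1 := fun n x ↦ by rw [abs_of_nonneg (h0 n x)]; exact h1 n x
  have hmeas : ∀ n, Measurable (F n) := fun n ↦ (hF n).continuous.measurable
  refine le_of_tendsto' (tendsto_finsetSum _ fun i _ ↦ tendsto_finsetSum _ fun j _ ↦
    tendsto_integral_of_dominated_convergence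
      (fun _ ↦ (1 / 2 * ∫ s in Ioo t 1, 1 / s * ∫ z, |densityHess i j z|) ^ 2)
      (F := fun n y ↦ (steinHess t (F n) i j y) ^ 2)
      (fun n ↦ (integrable_steinHess_sq ht (hmeas n) (hF1 n) i j _).aestronglyMeasurable)
      (integrable_const _) (fun n ↦ ae_of_all _ fun y ↦ by
        rw [Real.norm_eq_abs, abs_pow]
        exact pow_le_pow_left₀ (abs_nonneg _) (abs_steinHess_le ht (hF1 n) i j y) 2)
      (ae_of_all _ fun y ↦ (tendsto_steinHess ht hmeas hF1 hlim i j y).pow 2)) fun n ↦ ?_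
  simp_rw [steinHess_eq_timeAvg ht (hF n)]
  exact sum_integral_timeAvg_sq_le ht.1 ht.2 (hF n) (h0 n) (h1 n)

end Limit

/-! ### Second moments of signed mixtures. -/

section SecondMoment

variable {X Y : Type*} [MeasurableSpace X] [MeasurableSpace Y]

/-- Fubini for the second moment of a signed mixture. -/
lemma integral_sq_integral_mul {κ : Measure X} [SFinite κ] {ν : Measure Y} [IsProbabilityMeasure ν]
    {a : X → ℝ} (ha : Integrable a κ) {H : X → Y → ℝ}
    (hH : Measurable (Function.uncurry H)) (hH1 : ∀ p y, |H p y| ≤ 1) :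
    ∫ y, (∫ p, a p * H p y ∂κ) ^ 2 ∂ν =
      ∫ r, a r.1 * a r.2 * ∫ y, H r.1 y * H r.2 y ∂ν ∂(κ.prod κ) := by
  have ha2 : Integrable (fun r : X × X ↦ a r.1 * a r.2) (κ.prod κ) := ha.mul_prod ha
  have hH' : Measurable fun q : (X × X) × Y ↦ H q.1.1 q.2 * H q.1.2 q.2 :=
    (hH.comp (by fun_prop : Measurable fun q : (X × X) × Y ↦ (q.1.1, q.2))).mul
      (hH.comp (by fun_prop : Measurable fun q : (X × X) × Y ↦ (q.1.2, q.2)))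
  have hint : Integrable (fun q : (X × X) × Y ↦ a q.1.1 * a q.1.2 * (H q.1.1 q.2 * H q.1.2 q.2))
      ((κ.prod κ).prod ν) := by
    refine (ha2.comp_fst ν).mul_bdd (c := 1) hH'.aestronglyMeasurable (ae_of_all _ fun q ↦ ?_)
    rw [Real.norm_eq_abs, abs_mul]
    exact mul_le_one₀ (hH1 _ _) (abs_nonneg _) (hH1 _ _)
  calc ∫ y, (∫ p, a p * H p y ∂κ) ^ 2 ∂ν
      = ∫ y, ∫ r, a r.1 * a r.2 * (H r.1 y * H r.2 y) ∂(κ.prod κ) ∂ν := by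
        refine integral_congr_ae (ae_of_all _ fun y ↦ ?_)
        simp only
        rw [sq, ← integral_prod_mul]
        refine integral_congr_ae (ae_of_all _ fun r ↦ ?_)
        simp only
        ring
    _ = ∫ r, ∫ y, a r.1 * a r.2 * (H r.1 y * H r.2 y) ∂ν ∂(κ.prod κ) :=
        (integral_integral_swap hint).symm
    _ = _ := by simp_rw [integral_const_mul]

/-- Comparison of the second moments of a signed mixture under two laws. -/
lemma integral_sq_le_add {κ : Measure X} [SFinite κ] {ν ν' : Measure Y} [IsProbabilityMeasure ν]
    [IsProbabilityMeasure ν'] {a : X → ℝ} (ha : Integrable a κ) {H : X → Y → ℝ}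
    (hH : Measurable (Function.uncurry H)) (hH1 : ∀ p y, |H p y| ≤ 1) {d : ℝ} {T : Set X}
    (hT : ∀ᵐ p ∂κ, p ∈ T)
    (hd : ∀ p ∈ T, ∀ q ∈ T, |∫ y, H p y * H q y ∂ν - ∫ y, H p y * H q y ∂ν'| ≤ d) :
    ∫ y, (∫ p, a p * H p y ∂κ) ^ 2 ∂ν ≤
      (∫ p, |a p| ∂κ) ^ 2 * d + ∫ y, (∫ p, a p * H p y ∂κ) ^ 2 ∂ν' := by
  have ha2 : Integrable (fun r : X × X ↦ a r.1 * a r.2) (κ.prod κ) := ha.mul_prod ha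
  have hmeas : ∀ (μ : Measure Y) [IsProbabilityMeasure μ], Integrable
      (fun r : X × X ↦ a r.1 * a r.2 * ∫ y, H r.1 y * H r.2 y ∂μ) (κ.prod κ) := by
    intro μ _
    have hH' : Measurable fun q : (X × X) × Y ↦ H q.1.1 q.2 * H q.1.2 q.2 :=
      (hH.comp (by fun_prop : Measurable fun q : (X × X) × Y ↦ (q.1.1, q.2))).mul
        (hH.comp (by fun_prop : Measurable fun q : (X × X) × Y ↦ (q.1.2, q.2)))
    refine ha2.mul_bdd (c := 1)
      (hH'.stronglyMeasurable.integral_prod_right' (ν := μ)).aestronglyMeasurable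
      (ae_of_all _ fun r ↦ ?_)
    refine (norm_integral_le_of_norm_le_const (C := 1) (ae_of_all _ fun y ↦ ?_)).trans (by simp)
    rw [Real.norm_eq_abs, abs_mul]
    exact mul_le_one₀ (hH1 _ _) (abs_nonneg _) (hH1 _ _)
  have hT2 : ∀ᵐ r ∂(κ.prod κ), r.1 ∈ T ∧ r.2 ∈ T := by
    have h1 := Measure.quasiMeasurePreserving_fst (μ := κ) (ν := κ) |>.ae hT
    have h2 := Measure.quasiMeasurePreserving_snd (μ := κ) (ν := κ) |>.ae hT
    exact h1.and h2
  -- Once both squares are expanded, the integrands differ by a(p) a(q) times a quantity of modulus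
  -- at most d, for almost all p and q.
  rw [integral_sq_integral_mul ha hH hH1, integral_sq_integral_mul ha hH hH1, ← sub_le_iff_le_add,
    ← integral_sub (hmeas ν) (hmeas ν'), sq, ← integral_prod_mul, ← integral_mul_const]
  refine integral_mono_ae ((hmeas ν).sub (hmeas ν')) ((ha.abs.mul_prod ha.abs).mul_const d) ?_
  filter_upwards [hT2] with r hr
  rw [← mul_sub]
  refine (le_abs_self _).trans ?_
  rw [abs_mul, abs_mul]
  exact mul_le_mul_of_nonneg_left (hd _ hr.1 _ hr.2) (by positivity)

end SecondMoment

lemma integral_one_div_Ioo {t : ℝ} (ht : t ∈ Ioo (0 : ℝ) 1) :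
    ∫ s in Ioo t 1, 1 / s = -Real.log t := by
  rw [← integral_Ioc_eq_integral_Ioo, ← intervalIntegral.integral_of_le ht.2.le,
    integral_one_div_of_pos ht.1 one_pos, one_div, Real.log_inv]

lemma M₂_eq : M₂ m = 1 / 4 * ∑ i : Fin m, ∑ j : Fin m, (∫ z, |densityHess i j z|) ^ 2 := by
  simp_rw [M₂, partialDeriv₂_stdDensity]

/-! ### Comparison of the Hessian's second moment under two laws. -/

section Comparison

variable {t : ℝ} {h : Euc m → ℝ}

lemma steinHess_eq_integral_prod (ht : t ∈ Ioo (0 : ℝ) 1) (hh : Measurable h)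
    (hh1 : ∀ x, |h x| ≤ 1) (i j : Fin m) (y : Euc m) :
    steinHess t h i j y = ∫ p, (1 / 2 * (1 / p.1 * densityHess i j p.2)) *
      h (Real.sqrt p.1 • p.2 + Real.sqrt (1 - p.1) • y)
      ∂((volume.restrict (Ioo t 1)).prod (volume : Measure (Euc m))) := by
  have ha : Integrable (fun p : ℝ × Euc m ↦ 1 / 2 * (1 / p.1 * densityHess i j p.2))
      ((volume.restrict (Ioo t 1)).prod volume) :=
    (Integrable.mul_prod (integrableOn_inv ht) (integrable_densityHess i j)).const_mul _
  have hint : Integrable (fun p : ℝ × Euc m ↦ (1 / 2 * (1 / p.1 * densityHess i j p.2)) *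
      h (Real.sqrt p.1 • p.2 + Real.sqrt (1 - p.1) • y))
      ((volume.restrict (Ioo t 1)).prod volume) :=
    ha.mul_bdd (c := 1) (by fun_prop : Measurable _).aestronglyMeasurable
      (ae_of_all _ fun _ ↦ hh1 _)
  rw [integral_prod _ hint, steinHess, ← integral_const_mul]
  refine integral_congr_ae (ae_of_all _ fun s ↦ ?_)
  simp only [kernelAvg]
  rw [← integral_const_mul, ← integral_const_mul]
  refine integral_congr_ae (ae_of_all _ fun z ↦ ?_)
  simp only [smul_eq_mul]
  ring

/-- Each entry is a signed mixture of the functions h(√s z + √(1-s) y) with weight ∂_ijφ(z)/(2s),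
whose total mass is ½ |log t| ∫|∂_ijφ|. The squares of these masses sum to M₂ (log t)². -/
theorem sum_integral_steinHess_sq_le_add (ht : t ∈ Ioo (0 : ℝ) 1) (hh : Measurable h)
    (hh1 : ∀ x, |h x| ≤ 1) (ν ν' : Measure (Euc m)) [IsProbabilityMeasure ν]
    [IsProbabilityMeasure ν'] {d : ℝ}
    (hd : ∀ s ∈ Ioo (0 : ℝ) 1, ∀ z : Euc m, ∀ s' ∈ Ioo (0 : ℝ) 1, ∀ z' : Euc m,
      |∫ y, h (Real.sqrt s • z + Real.sqrt (1 - s) • y) *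
          h (Real.sqrt s' • z' + Real.sqrt (1 - s') • y) ∂ν -
        ∫ y, h (Real.sqrt s • z + Real.sqrt (1 - s) • y) *
          h (Real.sqrt s' • z' + Real.sqrt (1 - s') • y) ∂ν'| ≤ d) :
    ∑ i, ∑ j, ∫ y, (steinHess t h i j y) ^ 2 ∂ν ≤
      M₂ m * Real.log t ^ 2 * d + ∑ i, ∑ j, ∫ y, (steinHess t h i j y) ^ 2 ∂ν' := by
  have key : ∀ i j : Fin m, ∫ y, (steinHess t h i j y) ^ 2 ∂ν ≤
      (1 / 4 * (∫ z, |densityHess i j z|) ^ 2) * (Real.log t ^ 2 * d) +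
        ∫ y, (steinHess t h i j y) ^ 2 ∂ν' := by
    intro i j
    have ha : Integrable (fun p : ℝ × Euc m ↦ 1 / 2 * (1 / p.1 * densityHess i j p.2))
        ((volume.restrict (Ioo t 1)).prod volume) :=
      (Integrable.mul_prod (integrableOn_inv ht) (integrable_densityHess i j)).const_mul _
    have hT : ∀ᵐ p ∂((volume.restrict (Ioo t 1)).prod (volume : Measure (Euc m))),
        p ∈ {p : ℝ × Euc m | p.1 ∈ Ioo t 1} :=
      Measure.quasiMeasurePreserving_fst.ae (ae_restrict_mem measurableSet_Ioo)
    have hcmp := integral_sq_le_add (ν := ν) (ν' := ν') ha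
      (H := fun p y ↦ h (Real.sqrt p.1 • p.2 + Real.sqrt (1 - p.1) • y)) (d := d)
      (by unfold Function.uncurry; fun_prop) (fun _ _ ↦ hh1 _) hT
      fun p hp q hq ↦ hd p.1 ⟨ht.1.trans hp.1, hp.2⟩ p.2 q.1 ⟨ht.1.trans hq.1, hq.2⟩ q.2
    simp_rw [← steinHess_eq_integral_prod ht hh hh1] at hcmp
    refine hcmp.trans_eq ?_
    congr 1
    have e : ∫ p, |1 / 2 * (1 / p.1 * densityHess i j p.2)|
        ∂((volume.restrict (Ioo t 1)).prod (volume : Measure (Euc m))) =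
        1 / 2 * (-Real.log t * ∫ z, |densityHess i j z|) := by
      simp_rw [abs_mul]
      rw [integral_const_mul, integral_prod_mul (fun s : ℝ ↦ |1 / s|)
        (fun z ↦ |densityHess i j z|), abs_of_pos (by norm_num : (0 : ℝ) < 1 / 2),
        ← integral_one_div_Ioo ht]
      congr 2
      refine setIntegral_congr_fun measurableSet_Ioo fun s hs ↦ ?_
      have := ht.1.trans hs.1
      exact abs_of_pos (by positivity)
    rw [e]
    ring
  refine (Finset.sum_le_sum fun i _ ↦ Finset.sum_le_sum fun j _ ↦ key i j).trans_eq ?_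
  simp_rw [Finset.sum_add_distrib, ← Finset.sum_mul, ← Finset.mul_sum]
  rw [M₂_eq]
  ring

end Comparison

/-! ### The bound on `M₂`. -/

lemma integral_coord_sq (i : Fin m) : ∫ z : Euc m, (z i) ^ 2 ∂(stdGaussian (Euc m)) = 1 := by
  have h1 := variance_eval_multivariateGaussian (μ := (0 : Euc m))
    (Matrix.PosSemidef.one (n := Fin m) (R := ℝ)) (i := i)
  rw [multivariateGaussian_zero_one, variance_of_integral_eq_zero (by fun_prop)] at h1
  · simpa using h1
  · exact integral_strongDual_stdGaussian (EuclideanSpace.proj (𝕜 := ℝ) i)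

/-- The density factor z_i z_j − δ_ij is at most (z_i² + z_j²)/2 + 1 in modulus, which has Gaussian
mean 2. -/
lemma integral_abs_densityHess_le (i j : Fin m) : ∫ z, |densityHess i j z| ≤ 2 := by
  have hsq : ∀ k : Fin m, Integrable (fun z : Euc m ↦ (z k) ^ 2) (stdGaussian (Euc m)) := fun k ↦
    (integrable_norm_pow_stdGaussian 2).mono' (by fun_prop) (ae_of_all _ fun z ↦ by
      rw [Real.norm_eq_abs, abs_pow]
      exact pow_le_pow_left₀ (abs_nonneg _) (abs_coord_le z k) 2)
  have hg : Integrable (fun z : Euc m ↦ ((z i) ^ 2 + (z j) ^ 2) / 2 + 1) (stdGaussian (Euc m)) :=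
    (((hsq i).add (hsq j)).div_const 2).add (integrable_const 1)
  have hval : ∫ z : Euc m, (((z i) ^ 2 + (z j) ^ 2) / 2 + 1) ∂(stdGaussian (Euc m)) = 2 := by
    have hij : Integrable (fun z : Euc m ↦ ((z i) ^ 2 + (z j) ^ 2) / 2) (stdGaussian (Euc m)) :=
      ((hsq i).add (hsq j)).div_const 2
    rw [integral_add hij (integrable_const 1), integral_div,
      integral_add (hsq i) (hsq j), integral_coord_sq, integral_coord_sq]
    norm_num
  rw [← hval, integral_stdGaussian]
  refine integral_mono (integrable_densityHess i j).abs (integrable_stdGaussian_iff.1 hg)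
    fun z ↦ ?_
  simp only [smul_eq_mul]
  rw [densityHess_eq, abs_mul, abs_of_pos (stdDensity_pos z)]
  refine mul_le_mul_of_nonneg_left ((abs_sub _ _).trans (add_le_add ?_ ?_)) (stdDensity_pos z).le
  · rw [abs_le]
    constructor <;> nlinarith [sq_nonneg (z i + z j), sq_nonneg (z i - z j)]
  · split_ifs <;> simp

theorem M₂_le : M₂ m ≤ (m : ℝ) ^ 2 := by
  rw [M₂_eq]
  have h : ∑ i : Fin m, ∑ j : Fin m, (∫ z, |densityHess i j z|) ^ 2 ≤
      ∑ _i : Fin m, ∑ _j : Fin m, (4 : ℝ) := by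
    refine Finset.sum_le_sum fun i _ ↦ Finset.sum_le_sum fun j _ ↦ ?_
    have h0 : 0 ≤ ∫ z, |densityHess i j z| := integral_nonneg fun _ ↦ abs_nonneg _
    nlinarith [integral_abs_densityHess_le i j]
  simp only [Finset.sum_const, Finset.card_univ, Fintype.card_fin, nsmul_eq_mul] at h
  nlinarith

end SteinHessian

end

noncomputable section

namespace SteinHessian

open Filter Topology
open scoped MatrixOrder

variable {m : ℕ}

/-! ### Reduction of a general covariance to the identity. -/

lemma sum_sq_apply_comp_le (L : Euc m →L[ℝ] ℝ) (B : Euc m →L[ℝ] Euc m) :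
    ∑ i, (L (B (stdBasis i))) ^ 2 ≤ ‖B‖ ^ 2 * ∑ i, (L (stdBasis i)) ^ 2 := by
  have h : ∀ L : Euc m →L[ℝ] ℝ, ∑ i, (L (stdBasis i)) ^ 2 = ‖L‖ ^ 2 := fun L ↦ by
    rw [(EuclideanSpace.basisFun (Fin m) ℝ).norm_dual L]
    simp
  have h1 := h (L.comp B)
  simp only [ContinuousLinearMap.comp_apply] at h1
  rw [h1, h L, ← mul_pow, mul_comm]
  exact pow_le_pow_left₀ (norm_nonneg _) (L.opNorm_comp_le B) 2

/-- One factor ‖B‖² for each argument of D, the first argument being reached by flipping D. -/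
lemma sum_sum_sq_apply_comp_le (D : Euc m →L[ℝ] Euc m →L[ℝ] ℝ) (B : Euc m →L[ℝ] Euc m) :
    ∑ i, ∑ j, (D (B (stdBasis i)) (B (stdBasis j))) ^ 2 ≤
      (‖B‖ ^ 2) ^ 2 * ∑ i, ∑ j, (D (stdBasis i) (stdBasis j)) ^ 2 := by
  calc ∑ i, ∑ j, (D (B (stdBasis i)) (B (stdBasis j))) ^ 2
      ≤ ∑ i, ‖B‖ ^ 2 * ∑ j, (D (B (stdBasis i)) (stdBasis j)) ^ 2 :=
        Finset.sum_le_sum fun i _ ↦ sum_sq_apply_comp_le _ B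
    _ = ‖B‖ ^ 2 * ∑ j, ∑ i, (D.flip (stdBasis j) (B (stdBasis i))) ^ 2 := by
        rw [← Finset.mul_sum, Finset.sum_comm]; rfl
    _ ≤ ‖B‖ ^ 2 * ∑ j, ‖B‖ ^ 2 * ∑ i, (D.flip (stdBasis j) (stdBasis i)) ^ 2 :=
        mul_le_mul_of_nonneg_left
          (Finset.sum_le_sum fun j _ ↦ sum_sq_apply_comp_le _ B) (by positivity)
    _ = _ := by
        rw [← Finset.mul_sum, Finset.sum_comm, ← mul_assoc, ← sq]; rfl

section Transform

variable {S : Matrix (Fin m) (Fin m) ℝ} {t : ℝ} {h : Euc m → ℝ}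

/-- With z = √Σ w and y = √Σ (Σ^{-1/2} y), the map √Σ factors out of √s z + √(1-s) y and is absorbed
into h. -/
lemma steinIntegrand_eq_one (hS : S.PosDef) (h : Euc m → ℝ) (y : Euc m) (s : ℝ) :
    steinIntegrand h S y s = steinIntegrand (h ∘ sqrtCLM S) 1 (invSqrtCLM S y) s := by
  rw [steinIntegrand, integral_mul_gaussianDensity hS
    (fun z ↦ h (Real.sqrt s • z + Real.sqrt (1 - s) • y) - h z), steinIntegrand]
  simp only [Function.comp, map_add, map_smul, sqrtCLM_invSqrtCLM hS]

lemma steinSolution_eq_one (hS : S.PosDef) (t : ℝ) (h : Euc m → ℝ) :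
    steinSolution t h S = fun y ↦ steinSolution t (h ∘ sqrtCLM S) 1 (invSqrtCLM S y) := by
  ext y
  simp_rw [steinSolution, steinIntegrand_eq_one hS]

lemma measurable_comp_sqrtCLM (hh : Measurable h) : Measurable (h ∘ sqrtCLM S) :=
  hh.comp (sqrtCLM S).measurable

theorem intervalIntegrable_steinIntegrand (hS : S.PosDef) (ht : t ∈ Ioo (0 : ℝ) 1)
    (hh : Measurable h) (hh1 : ∀ x, |h x| ≤ 1) (y : Euc m) :
    IntervalIntegrable (steinIntegrand h S y) volume t 1 := by
  rw [funext fun s ↦ steinIntegrand_eq_one hS h y s]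
  exact intervalIntegrable_steinIntegrand_one ht (measurable_comp_sqrtCLM hh) (fun _ ↦ hh1 _) _

theorem contDiff_steinSolution (hS : S.PosDef) (ht : t ∈ Ioo (0 : ℝ) 1) (hh : Measurable h)
    (hh1 : ∀ x, |h x| ≤ 1) : ContDiff ℝ 2 (steinSolution t h S) := by
  obtain ⟨f', f'', h1, h2, h3, -⟩ := steinSolution_one_spec ht
    (measurable_comp_sqrtCLM (S := S) hh) (fun _ ↦ hh1 _)
  have hf : ContDiff ℝ 2 (steinSolution t (h ∘ sqrtCLM S) 1) := by
    have : ContDiff ℝ ((1 : ℕ) + 1) (steinSolution t (h ∘ sqrtCLM S) 1) :=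
      contDiff_succ_iff_hasFDerivAt.2 ⟨f', by
        exact_mod_cast contDiff_one_iff_hasFDerivAt.2 ⟨f'', h3, h2⟩, h1⟩
    exact_mod_cast this
  rw [steinSolution_eq_one hS]
  exact hf.comp (invSqrtCLM S).contDiff

lemma hessianSqNorm_steinSolution_le (hS : S.PosDef) (ht : t ∈ Ioo (0 : ℝ) 1) (hh : Measurable h)
    (hh1 : ∀ x, |h x| ≤ 1) (y : Euc m) :
    hessianSqNorm (steinSolution t h S) y ≤ opNorm S⁻¹ ^ 2 *
      ∑ i, ∑ j, (steinHess t (h ∘ sqrtCLM S) i j (invSqrtCLM S y)) ^ 2 := by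
  obtain ⟨f', f'', h1, h2, h3, h4⟩ := steinSolution_one_spec ht
    (measurable_comp_sqrtCLM (S := S) hh) (fun _ ↦ hh1 _)
  set B := invSqrtCLM S with hB
  have d1 : ∀ y, HasFDerivAt (steinSolution t h S) ((f' (B y)).comp B) y := fun y ↦ by
    rw [steinSolution_eq_one hS]
    exact (h1 (B y)).comp y B.hasFDerivAt
  have hlin : ∀ y, HasFDerivAt (fun L : Euc m →L[ℝ] ℝ ↦ L.comp B)
      ((ContinuousLinearMap.compL ℝ (Euc m) (Euc m) ℝ).flip B) y := fun y ↦
    ((ContinuousLinearMap.compL ℝ (Euc m) (Euc m) ℝ).flip B).hasFDerivAt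
  have d2 : ∀ y, HasFDerivAt (fun y ↦ (f' (B y)).comp B)
      (((ContinuousLinearMap.compL ℝ (Euc m) (Euc m) ℝ).flip B).comp ((f'' (B y)).comp B)) y :=
    fun y ↦ (hlin _).comp y ((h2 (B y)).comp y B.hasFDerivAt)
  have e : ∀ i j, partialDeriv₂ i j (steinSolution t h S) y =
      f'' (B y) (B (stdBasis i)) (B (stdBasis j)) := fun i j ↦
    partialDeriv₂_of_hasFDerivAt d1 d2 i j y
  simp_rw [hessianSqNorm, e, ← h4]
  rw [← norm_invSqrtCLM_sq hS]
  exact sum_sum_sq_apply_comp_le _ _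

end Transform

/-! ### The bound for an abstract class of test functions. -/

lemma abs_indicator_one_le (A : Set (Euc m)) (x : Euc m) :
    |indicator A (fun _ ↦ (1 : ℝ)) x| ≤ 1 := by
  by_cases h : x ∈ A <;> simp [h]

/-- The abstract form of the bound, for the indicator of a closed set and a class of test functions
that contains the products of its rescaled translates. -/
theorem lintegral_hessianSqNorm_le (hm : 0 < m) {Ω Ω' : Type*} [MeasurableSpace Ω]
    [MeasurableSpace Ω'] (P : Measure Ω) [IsProbabilityMeasure P] (Q : Measure Ω')
    [IsProbabilityMeasure Q] (Y : Ω → Euc m) (hY : AEMeasurable Y P)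
    {S : Matrix (Fin m) (Fin m) ℝ} (hS : S.PosDef) (N : Ω' → Euc m)
    (hN : HasLaw N (multivariateGaussian 0 S) Q) {t : ℝ} (ht : t ∈ Ioo (0 : ℝ) 1)
    {A : Set (Euc m)} (hA : IsClosed A) {G : Set (Euc m → ℝ)} (hG : ∀ g ∈ G, ∀ x, |g x| ≤ 1)
    (hprod : ∀ s ∈ Ioo (0 : ℝ) 1, ∀ a : Euc m, ∀ s' ∈ Ioo (0 : ℝ) 1, ∀ a' : Euc m,
      (fun x ↦ indicator A (fun _ ↦ (1 : ℝ)) (a + Real.sqrt (1 - s) • x) *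
        indicator A (fun _ ↦ (1 : ℝ)) (a' + Real.sqrt (1 - s') • x)) ∈ G) :
    ∫⁻ ω, ENNReal.ofReal
        (hessianSqNorm (steinSolution t (indicator A fun _ ↦ 1) S) (Y ω)) ∂P ≤
      ENNReal.ofReal (opNorm S⁻¹ ^ 2 * (M₂ m * Real.log t ^ 2 * testDist G P Y Q N +
        444 * (m : ℝ) ^ (23 / 6 : ℝ))) := by
  set h : Euc m → ℝ := indicator A fun _ ↦ 1 with hh
  set h' : Euc m → ℝ := h ∘ sqrtCLM S with hh'
  have hmeas : Measurable h := measurable_const.indicator hA.measurableSet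
  have h1 : ∀ x, |h x| ≤ 1 := abs_indicator_one_le A
  have hmeas' : Measurable h' := measurable_comp_sqrtCLM hmeas
  have h1' : ∀ x, |h' x| ≤ 1 := fun x ↦ h1 _
  have eh' : h' = indicator (sqrtCLM S ⁻¹' A) fun _ ↦ 1 := rfl
  have hBY : AEMeasurable (fun ω ↦ invSqrtCLM S (Y ω)) P :=
    (invSqrtCLM S).measurable.comp_aemeasurable hY
  set ν := P.map (fun ω ↦ invSqrtCLM S (Y ω)) with hν
  have : IsProbabilityMeasure ν := Measure.isProbabilityMeasure_map hBY
  have hdist : ∀ g ∈ G, |(∫ ω, g (Y ω) ∂P) - ∫ ω, g (N ω) ∂Q| ≤ testDist G P Y Q N := by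
    intro g hg
    -- The real supremum is meaningful only for a bounded family; 2 is a bound because |g| ≤ 1.
    refine le_ciSup (f := fun g : G ↦ |(∫ ω, g.1 (Y ω) ∂P) - ∫ ω, g.1 (N ω) ∂Q|)
      ⟨2, ?_⟩ ⟨g, hg⟩
    rintro _ ⟨⟨g, hg⟩, rfl⟩
    have b1 : |∫ ω, g (Y ω) ∂P| ≤ 1 := by
      have := norm_integral_le_of_norm_le_const (μ := P) (C := 1) (f := fun ω ↦ g (Y ω))
        (ae_of_all _ fun ω ↦ hG g hg (Y ω))
      simpa using this
    have b2 : |∫ ω, g (N ω) ∂Q| ≤ 1 := by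
      have := norm_integral_le_of_norm_le_const (μ := Q) (C := 1) (f := fun ω ↦ g (N ω))
        (ae_of_all _ fun ω ↦ hG g hg (N ω))
      simpa using this
    refine (abs_sub _ _).trans (by linarith)
  have hQ : ∀ q : Euc m → ℝ, Measurable q →
      ∫ ω, q (N ω) ∂Q = ∫ w, q (sqrtCLM S w) ∂(stdGaussian (Euc m)) := by
    intro q hq
    rw [← integral_map hN.aemeasurable hq.aestronglyMeasurable, hN.map_eq, multivariateGaussian,
      integral_map (by fun_prop) hq.aestronglyMeasurable]
    simp only [zero_add]
    rfl
  -- The √Σ inside h' cancels the Σ^{-1/2} applied to Y, leaving products of rescaled translates of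
  -- h at Y itself. Hence d is the distance between Y and N in the original coordinates.
  have hcmp := sum_integral_steinHess_sq_le_add ht hmeas' h1' ν (stdGaussian (Euc m))
    (d := testDist G P Y Q N) (by
      intro s hs z s' hs' z'
      have hq := hdist _ (hprod s hs (sqrtCLM S (Real.sqrt s • z)) s' hs'
        (sqrtCLM S (Real.sqrt s' • z')))
      rw [hQ (fun x ↦ h (sqrtCLM S (Real.sqrt s • z) + Real.sqrt (1 - s) • x) *
        h (sqrtCLM S (Real.sqrt s' • z') + Real.sqrt (1 - s') • x)) (by fun_prop)] at hq
      rw [hν, integral_map hBY (by fun_prop : Measurable _).aestronglyMeasurable]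
      simpa only [hh', Function.comp, map_add, map_smul, sqrtCLM_invSqrtCLM hS] using hq)
  have hgauss := sum_integral_steinHess_sq_le ht (hA.preimage (sqrtCLM S).continuous)
  rw [← eh'] at hgauss
  have hint : ∀ i j, Integrable (fun ω ↦ (steinHess t h' i j (invSqrtCLM S (Y ω))) ^ 2) P :=
    fun i j ↦ (integrable_steinHess_sq ht hmeas' h1' i j ν).comp_aemeasurable hBY
  -- The Gaussian term is at most 1, far below the stated constant since m ≥ 1.
  have hconst : 1 ≤ 444 * (m : ℝ) ^ (23 / 6 : ℝ) := by
    have : 1 ≤ (m : ℝ) ^ (23 / 6 : ℝ) :=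
      Real.one_le_rpow (by exact_mod_cast hm) (by norm_num)
    linarith
  calc ∫⁻ ω, ENNReal.ofReal (hessianSqNorm (steinSolution t h S) (Y ω)) ∂P
      ≤ ∫⁻ ω, ENNReal.ofReal (opNorm S⁻¹ ^ 2 *
          ∑ i, ∑ j, (steinHess t h' i j (invSqrtCLM S (Y ω))) ^ 2) ∂P :=
        lintegral_mono fun ω ↦ ENNReal.ofReal_le_ofReal
          (hessianSqNorm_steinSolution_le hS ht hmeas h1 (Y ω))
    _ = ENNReal.ofReal (opNorm S⁻¹ ^ 2 * ∑ i, ∑ j, ∫ y, (steinHess t h' i j y) ^ 2 ∂ν) := by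
        rw [← ofReal_integral_eq_lintegral_ofReal
          ((integrable_finsetSum _ fun i _ ↦ integrable_finsetSum _ fun j _ ↦ hint i j).const_mul _)
          (ae_of_all _ fun ω ↦ by positivity), integral_const_mul,
          integral_finsetSum _ fun i _ ↦ integrable_finsetSum _ fun j _ ↦ hint i j]
        congr 2
        refine Finset.sum_congr rfl fun i _ ↦ ?_
        rw [integral_finsetSum _ fun j _ ↦ hint i j]
        refine Finset.sum_congr rfl fun j _ ↦ ?_
        rw [hν, integral_map hBY
          ((measurable_steinHess ht hmeas' h1' i j).pow_const 2).aestronglyMeasurable]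
    _ ≤ _ := by
        refine ENNReal.ofReal_le_ofReal (mul_le_mul_of_nonneg_left ?_ (by positivity))
        linarith

/-! ### Stability of the two classes under products of rescaled translates. -/

section Classes

lemma indicator_mul_comp_eq (A : Set (Euc m)) (f g : Euc m → Euc m) :
    (fun x ↦ indicator A (fun _ ↦ (1 : ℝ)) (f x) * indicator A (fun _ ↦ (1 : ℝ)) (g x)) =
      indicator (f ⁻¹' A ∩ g ⁻¹' A) fun _ ↦ 1 := by
  ext x
  by_cases h1 : f x ∈ A <;> by_cases h2 : g x ∈ A <;> simp [h1, h2]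

lemma IsClosedHalfSpace.isClosed {H : Set (Euc m)} (hH : IsClosedHalfSpace H) : IsClosed H := by
  obtain ⟨u, c, -, rfl⟩ := hH
  exact isClosed_le (by fun_prop) continuous_const

lemma IsClosedHalfSpace.preimage {H : Set (Euc m)} (hH : IsClosedHalfSpace H) (a : Euc m) {b : ℝ}
    (hb : 0 < b) : IsClosedHalfSpace ((fun x ↦ a + b • x) ⁻¹' H) := by
  obtain ⟨u, c, hu, rfl⟩ := hH
  refine ⟨u, (c - inner ℝ a u) / b, hu, ?_⟩
  ext x
  simp only [mem_preimage, mem_ofPred_eq, inner_add_left, real_inner_smul_left]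
  rw [le_div_iff₀ hb, le_sub_iff_add_le', mul_comm]

/-- A positive dilation and a translation keep the unit normal of a half-space. Multiplying the
indicators concatenates two families of l half-spaces, whence 2l. -/
lemma mul_mem_halfSpaceIndicators {l : ℕ} {H : Fin l → Set (Euc m)}
    (hH : ∀ k, IsClosedHalfSpace (H k)) (a a' : Euc m) {b b' : ℝ} (hb : 0 < b) (hb' : 0 < b') :
    (fun x ↦ indicator (⋂ k, H k) (fun _ ↦ (1 : ℝ)) (a + b • x) *
      indicator (⋂ k, H k) (fun _ ↦ (1 : ℝ)) (a' + b' • x)) ∈ halfSpaceIndicators m (2 * l) := by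
  let H₁ : Fin l → Set (Euc m) := fun k ↦ (fun x ↦ a + b • x) ⁻¹' H k
  let H₂ : Fin l → Set (Euc m) := fun k ↦ (fun x ↦ a' + b' • x) ⁻¹' H k
  refine ⟨fun k ↦ Fin.append H₁ H₂ (Fin.cast (two_mul l) k), fun k ↦ ?_, ?_⟩
  · refine Fin.addCases (motive := fun k ↦ IsClosedHalfSpace (Fin.append H₁ H₂ k))
      (fun k ↦ ?_) (fun k ↦ ?_) (Fin.cast (two_mul l) k)
    · rw [Fin.append_left]; exact (hH k).preimage a hb
    · rw [Fin.append_right]; exact (hH k).preimage a' hb'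
  · rw [indicator_mul_comp_eq]
    congr 1
    ext x
    simp only [mem_inter_iff, mem_preimage, mem_iInter]
    constructor
    · rintro ⟨h1, h2⟩ k
      refine Fin.addCases (motive := fun k ↦ x ∈ Fin.append H₁ H₂ k)
        (fun k ↦ ?_) (fun k ↦ ?_) (Fin.cast (two_mul l) k)
      · rw [Fin.append_left]; exact h1 k
      · rw [Fin.append_right]; exact h2 k
    · refine fun h ↦ ⟨fun k ↦ ?_, fun k ↦ ?_⟩
      · have := h (Fin.cast (two_mul l).symm (Fin.castAdd l k))
        rw [Fin.cast_cast, Fin.cast_eq_self, Fin.append_left] at this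
        exact this
      · have := h (Fin.cast (two_mul l).symm (Fin.natAdd l k))
        rw [Fin.cast_cast, Fin.cast_eq_self, Fin.append_right] at this
        exact this

lemma convex_preimage_affine {A : Set (Euc m)} (hA : Convex ℝ A) (a : Euc m) (b : ℝ) :
    Convex ℝ ((fun x ↦ a + b • x) ⁻¹' A) := by
  intro x hx y hy α β hα hβ hαβ
  have e : a + b • (α • x + β • y) = α • (a + b • x) + β • (a + b • y) := by
    have : a = (α + β) • a := by rw [hαβ, one_smul]
    nth_rewrite 1 [this]
    module
  change a + b • (α • x + β • y) ∈ A
  rw [e]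
  exact hA hx hy hα hβ hαβ

/-- Closed convex sets are stable under affine preimages and intersection, so this class need not be
enlarged. -/
lemma mul_mem_convexIndicators {A : Set (Euc m)} (hA : IsClosed A) (hA' : Convex ℝ A)
    (a a' : Euc m) (b b' : ℝ) :
    (fun x ↦ indicator A (fun _ ↦ (1 : ℝ)) (a + b • x) *
      indicator A (fun _ ↦ (1 : ℝ)) (a' + b' • x)) ∈ convexIndicators m := by
  refine ⟨(fun x ↦ a + b • x) ⁻¹' A ∩ (fun x ↦ a' + b' • x) ⁻¹' A,
    (hA.preimage (by fun_prop)).inter (hA.preimage (by fun_prop)),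
    (convex_preimage_affine hA' a b).inter (convex_preimage_affine hA' a' b'),
    indicator_mul_comp_eq A _ _⟩

end Classes

end SteinHessian

end

theorem proposition2p4 {m : ℕ} (hm : 0 < m)
    {Ω Ω' : Type*} [MeasurableSpace Ω] [MeasurableSpace Ω']
    (P : Measure Ω) [IsProbabilityMeasure P] (Q : Measure Ω') [IsProbabilityMeasure Q]
    (Y : Ω → EuclideanSpace ℝ (Fin m)) (hY : AEMeasurable Y P)
    (S : Matrix (Fin m) (Fin m) ℝ) (hS : S.PosDef)
    (N : Ω' → EuclideanSpace ℝ (Fin m)) (hN : HasLaw N (multivariateGaussian 0 S) Q) :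
    SteinHessian.M₂ m ≤ (m : ℝ) ^ 2 ∧
    (∀ t ∈ Ioo (0 : ℝ) 1, ∀ l : ℕ, 0 < l →
      (∀ h ∈ SteinHessian.halfSpaceIndicators m l,
        (∀ y, IntervalIntegrable (SteinHessian.steinIntegrand h S y) volume t 1) ∧
        ContDiff ℝ 2 (SteinHessian.steinSolution t h S)) ∧
      (⨆ h ∈ SteinHessian.halfSpaceIndicators m l,
          ∫⁻ ω, ENNReal.ofReal
            (SteinHessian.hessianSqNorm (SteinHessian.steinSolution t h S) (Y ω)) ∂P) ≤
        ENNReal.ofReal (SteinHessian.opNorm S⁻¹ ^ 2 *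
          (SteinHessian.M₂ m * Real.log t ^ 2 *
              SteinHessian.testDist (SteinHessian.halfSpaceIndicators m (2 * l)) P Y Q N +
            444 * (m : ℝ) ^ (23 / 6 : ℝ)))) ∧
    (∀ t ∈ Ioo (0 : ℝ) 1,
      (∀ h ∈ SteinHessian.convexIndicators m,
        (∀ y, IntervalIntegrable (SteinHessian.steinIntegrand h S y) volume t 1) ∧
        ContDiff ℝ 2 (SteinHessian.steinSolution t h S)) ∧
      (⨆ h ∈ SteinHessian.convexIndicators m,
          ∫⁻ ω, ENNReal.ofReal
            (SteinHessian.hessianSqNorm (SteinHessian.steinSolution t h S) (Y ω)) ∂P) ≤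
        ENNReal.ofReal (SteinHessian.opNorm S⁻¹ ^ 2 *
          (SteinHessian.M₂ m * Real.log t ^ 2 *
              SteinHessian.testDist (SteinHessian.convexIndicators m) P Y Q N +
            444 * (m : ℝ) ^ (23 / 6 : ℝ)))) := by
  -- Strict positivity matters for half-spaces: under a dilation by 0 the preimage would be empty or
  -- the whole space.
  have hsqrt : ∀ s ∈ Ioo (0 : ℝ) 1, 0 < Real.sqrt (1 - s) := fun s hs ↦
    Real.sqrt_pos.2 (by linarith [hs.2])
  refine ⟨SteinHessian.M₂_le, fun t ht l _ ↦ ⟨?_, iSup₂_le ?_⟩, fun t ht ↦ ⟨?_, iSup₂_le ?_⟩⟩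
  · rintro _ ⟨H, hH, rfl⟩
    have hm1 : Measurable (indicator (⋂ k, H k) fun _ ↦ (1 : ℝ)) :=
      measurable_const.indicator (isClosed_iInter fun k ↦ (hH k).isClosed).measurableSet
    have hb := SteinHessian.abs_indicator_one_le (⋂ k, H k)
    exact ⟨SteinHessian.intervalIntegrable_steinIntegrand hS ht hm1 hb,
      SteinHessian.contDiff_steinSolution hS ht hm1 hb⟩
  · rintro _ ⟨H, hH, rfl⟩
    refine SteinHessian.lintegral_hessianSqNorm_le hm P Q Y hY hS N hN ht
      (isClosed_iInter fun k ↦ (hH k).isClosed) ?_ fun s hs a s' hs' a' ↦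
        SteinHessian.mul_mem_halfSpaceIndicators hH a a' (hsqrt s hs) (hsqrt s' hs')
    rintro _ ⟨H, -, rfl⟩
    exact SteinHessian.abs_indicator_one_le _
  · rintro _ ⟨A, hA, -, rfl⟩
    have hm1 : Measurable (indicator A fun _ ↦ (1 : ℝ)) :=
      measurable_const.indicator hA.measurableSet
    have hb := SteinHessian.abs_indicator_one_le A
    exact ⟨SteinHessian.intervalIntegrable_steinIntegrand hS ht hm1 hb,
      SteinHessian.contDiff_steinSolution hS ht hm1 hb⟩
  · rintro _ ⟨A, hA, hA', rfl⟩
    refine SteinHessian.lintegral_hessianSqNorm_le hm P Q Y hY hS N hN ht hA ?_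
      fun s _ a s' _ a' ↦ SteinHessian.mul_mem_convexIndicators hA hA' a a' _ _
    rintro _ ⟨A, -, -, rfl⟩
    exact SteinHessian.abs_indicator_one_le _
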